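/- **Setting.** For each sample size $n$ let $x_1,\dots,x_n\in\mathbb R^{p_n}$ be given (non-random) covariate vectors, and let $\sigma^2>0$ be known. Change points $0<t_1<\dots<t_l<1$ (with $t_0=0$, $t_{l+1}=1$) split the time indices $\{1,\dots,n\}$ into the $l+1$ segments $P_j=\{i: nt_{j-1}<i\le nt_j\}$, $j=1,\dots,l+1$. A model $M_{l,m}$ consists of change points $t_1<\dots<t_l$ and a covariate set $m\subseteq\{1,\dots,p_n\}$. Under $M_{l,m}$, the $y_i\sim\mathcal N(x_i'\beta_j,\sigma^2)$, $i\in P_j$, are independent given the coefficients, and the coefficients $\beta_{j,k}$ are independent with the spike-and-slab prior $\beta_{j,k}\sim\mathcal N(0,V_n)$ if $k\in m$ and $\beta_{j,k}=0$ if $k\notin m$. Let $L(y\mid M)$ be the marginal likelihood (the likelihood integrated over this prior), and let $BF(M,M')=L(y\mid M)/L(y\mid M')$ be the Bayes factor. The truth has $l^*\ge 0$ change points $t^*_1<\dots<t^*_{l^*}$, not depending on $n$, with segments $P_j^*$, and coefficient vectors $\beta^{*1},\dots,\beta^{*(l^*+1)}\in\mathbb R^{p_n}$ (possibly depending on $n$):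 the $y_i\sim\mathcal N(x_i'\beta^{*j},\sigma^2)$, $i\in P^*_j$, are independent. Let $m^*=m^*_n=\{k:\beta^{*j}_k\ne0\text{ for some }j\}$ be the set of true covariates, and let $M^*$ be the model with change points $t^*_1<\dots<t^*_{l^*}$ and covariate set $m^*$. Let $q_n$ be the maximal number of covariates permitted in a model; in particular $|m^*|\le q_n$. **Theorem.** Fix change points $0<t_1<\dots<t_l<1$, not depending on $n$, with $l\ne l^*$, and for each $n$ let $m=m_n$ be any covariate set with $|m|\le q_n$, such that $m\cup m^*\neq\emptyset$. Assume: * (A1) The covariates $x_{i,k}$ are bounded in absolute value, uniformly in $n,i,k$. * (A2) There are constants $c,C,\delta>0$, not depending on $n$, such that $c\le|\beta^{*j}_k|\le C$ whenever $\beta^{*j}_k\neq0$, and $\|\beta^{*(j+1)}-\beta^{*j}\|_2^2\ge\delta$ for $j=1,\dots,l^*$. (If the true coefficients do not depend on $n$, the latter only says that $\beta^{*j}\ne\beta^{*(j+1)}$.) * (A3) $q_n^2=O(n^{c_0})$ for some $c_0<1/2$, and $(q_n\log n)^2=o(n\epsilon_n)$ for positive numbers $\epsilon_n\to0$ with $n\epsilon_n\to\infty$.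 * (A4) The slab variance $V_n$ is of order one: $0<v_0\le V_n\le v_1<\infty$ for all $n$. * (A5) $0<t^*_1<\dots<t^*_{l^*}<1$. * (A6) There are constants $a,b>0$ such that the following holds for any finite family of disjoint intervals $(u_1,v_1],\dots,(u_K,v_K]\subseteq(0,1]$, $u_i<v_i$. Let $\tilde P_i=\{r\in\{1,\dots,n\}: nu_i<r\le nv_i\}$ be the corresponding blocks of time indices, $n_i=|\tilde P_i|$, and let $X_i$ be the design matrix of the observations in $\tilde P_i$ and the covariates in $m\cup m^*$. Then for all sufficiently large $n$ and every $i$, all singular values of $X_i'X_i$ lie strictly between $a n_i$ and $b n_i$, and all singular values of $(X_1'X_1+\dots+X_K'X_K)^{-1}X_i'X_i$ lie strictly between $a\,n_i/(n_1+\dots+n_K)$ and $b\,n_i/(n_1+\dots+n_K)$. Then $BF(M_{l,m},M^*)\to0$ in probability as $n\to\infty$, where $y$ follows the true distribution. -/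

import Mathlib

open MeasureTheory ProbabilityTheory Filter Topology Asymptotics
open scoped NNReal ENNReal

noncomputable section

/-- `t 0 < t 1 < ... < t (l - 1)` are `l` change point locations inside `(0, 1)`. -/
def IsChangePoints {l : ℕ} (t : Fin l → ℝ) : Prop :=
  StrictMono t ∧ ∀ k, 0 < t k ∧ t k < 1

open Classical in
/-- The (zero-based) number of the segment that contains the observation `i`, whose time index is
`i + 1 ∈ {1, ..., n}`.  With `t_0 = 0` and `t_{l+1} = 1`, the `j`-th segment consists of the time
indices in `(n t_j, n t_{j+1}]`, so `j` is the number of change points `t_k` with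
`n t_k < i + 1`. -/
def segmentIndex {l : ℕ} (n : ℕ) (t : Fin l → ℝ) (i : Fin n) : Fin (l + 1) :=
  ⟨(Finset.univ.filter fun k : Fin l => (n : ℝ) * t k < (i : ℝ) + 1).card,
    Nat.lt_succ_of_le ((Finset.card_le_univ _).trans (Fintype.card_fin l).le)⟩

/-- The prior of the array of coefficients `β j k` (segment `j`, covariate `k`) given the model
with `l` change points and covariate set `m`: independent coordinates, with the slab `N(0, V)`
for `k ∈ m` and the spike `δ_0` for `k ∉ m`. -/
def coefficientPrior (l p : ℕ) (V : ℝ≥0) (m : Finset (Fin p)) :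
    Measure (Fin (l + 1) → Fin p → ℝ) :=
  Measure.pi fun _ : Fin (l + 1) =>
    Measure.pi fun k : Fin p => if k ∈ m then gaussianReal 0 V else Measure.dirac 0

/-- The mean of the observation `i` when the change points are `t` and the coefficients are `β`. -/
def regressionMean {n p l : ℕ} (x : Fin n → Fin p → ℝ) (t : Fin l → ℝ)
    (β : Fin (l + 1) → Fin p → ℝ) (i : Fin n) : ℝ :=
  ∑ k, x i k * β (segmentIndex n t i) k

/-- The marginal likelihood `L(y ∣ M)` of the model `M` with change points `t` and covariate set
`m`: the Gaussian likelihood with known variance `σ2`, integrated over the prior of the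
coefficients. -/
def marginalLikelihood {n p l : ℕ} (x : Fin n → Fin p → ℝ) (σ2 V : ℝ≥0) (t : Fin l → ℝ)
    (m : Finset (Fin p)) (y : Fin n → ℝ) : ℝ :=
  ∫ β, ∏ i, gaussianPDFReal (regressionMean x t β i) σ2 (y i) ∂(coefficientPrior l p V m)

/-- The Bayes factor of the model with change points `t` and covariate set `m` against the model
with change points `t'` and covariate set `m'`. -/
def bayesFactor {n p l l' : ℕ} (x : Fin n → Fin p → ℝ) (σ2 V : ℝ≥0)
    (t : Fin l → ℝ) (m : Finset (Fin p)) (t' : Fin l' → ℝ) (m' : Finset (Fin p))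
    (y : Fin n → ℝ) : ℝ :=
  marginalLikelihood x σ2 V t m y / marginalLikelihood x σ2 V t' m' y

open Classical in
/-- The covariates that are active in at least one segment. -/
def activeCovariates {l p : ℕ} (β : Fin (l + 1) → Fin p → ℝ) : Finset (Fin p) :=
  Finset.univ.filter fun k => ∃ j, β j k ≠ 0

/-- The true law of the response: independent `y i ∼ N(xᵢ' βⱼ, σ2)`, `j` the segment of `i`. -/
def responseLaw {n p l : ℕ} (x : Fin n → Fin p → ℝ) (σ2 : ℝ≥0) (t : Fin l → ℝ)
    (β : Fin (l + 1) → Fin p → ℝ) : Measure (Fin n → ℝ) :=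
  Measure.pi fun i => gaussianReal (regressionMean x t β i) σ2

open Classical in
/-- The observations with time index in the block `(n u, n v]`. -/
def timeBlock (n : ℕ) (u v : ℝ) : Finset (Fin n) :=
  Finset.univ.filter fun i => (n : ℝ) * u < (i : ℝ) + 1 ∧ (i : ℝ) + 1 ≤ (n : ℝ) * v

/-- The design matrix of the observations in `P` and the covariates in `m`. -/
def designMatrix {n p : ℕ} (x : Fin n → Fin p → ℝ) (P : Finset (Fin n)) (m : Finset (Fin p)) :
    Matrix P m ℝ :=
  Matrix.of fun i k => x i k

/-- The matrix `X' X` for the design matrix `X` of the observations `P` and covariates `m`. -/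
def gramMatrix {n p : ℕ} (x : Fin n → Fin p → ℝ) (P : Finset (Fin n)) (m : Finset (Fin p)) :
    Matrix m m ℝ :=
  (designMatrix x P m).transpose * designMatrix x P m

/-- All singular values of the square matrix `M` lie strictly between `lo` and `hi`. -/
def SingularValuesBetween {κ : Type} [Fintype κ] [DecidableEq κ] (lo hi : ℝ)
    (M : Matrix κ κ ℝ) : Prop :=
  ∀ r < Fintype.card κ, lo < (Matrix.toEuclideanLin M).singularValues r ∧
    (Matrix.toEuclideanLin M).singularValues r < hi

/-- The covariates are uniformly bounded. -/
def CovariatesBounded {p : ℕ → ℕ} (x : (n : ℕ) → Fin n → Fin (p n) → ℝ) : Prop :=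
  ∃ K : ℝ, ∀ n i k, |x n i k| ≤ K

/-- The nonzero true coefficients are bounded above and away from zero, uniformly in `n`, and
so are the jumps between consecutive coefficient vectors away from zero (for coefficients that do
not depend on `n`, the latter says just that consecutive vectors differ). -/
def CoefficientsBounded {p : ℕ → ℕ} {l : ℕ} (β : (n : ℕ) → Fin (l + 1) → Fin (p n) → ℝ) : Prop :=
  (∃ c C : ℝ, 0 < c ∧ ∀ n j k, β n j k ≠ 0 → c ≤ |β n j k| ∧ |β n j k| ≤ C) ∧
  ∃ δ : ℝ, 0 < δ ∧ ∀ n (j : Fin l), δ ≤ ∑ k, (β n j.succ k - β n j.castSucc k) ^ 2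

/-- The growth condition on the maximal model size `q n`. -/
def ModelSizeCondition (q : ℕ → ℕ) (ε : ℕ → ℝ) : Prop :=
  (∀ n, 0 < ε n) ∧ Tendsto ε atTop (𝓝 0) ∧ Tendsto (fun n : ℕ => (n : ℝ) * ε n) atTop atTop ∧
  (fun n : ℕ => ((q n : ℝ) * Real.log n) ^ 2) =o[atTop] (fun n : ℕ => (n : ℝ) * ε n) ∧
  ∃ c : ℝ, c < 1 / 2 ∧ (fun n : ℕ => (q n : ℝ) ^ 2) =O[atTop] (fun n : ℕ => (n : ℝ) ^ c)

/-- The slab variance is of order one: bounded above and away from zero. -/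
def SlabVarianceCondition (V : ℕ → ℝ≥0) : Prop :=
  ∃ v₀ v₁ : ℝ≥0, 0 < v₀ ∧ ∀ n, v₀ ≤ V n ∧ V n ≤ v₁

/-- The singular value condition for the covariate sets `m n`: with constants `a, b > 0` and
for any finite family of disjoint blocks of time points, `X_i' X_i` has singular values between
`a n_i` and `b n_i`, and `(∑ j, X_j' X_j)⁻¹ X_i' X_i` has singular values between
`a n_i / ∑ j, n_j` and `b n_i / ∑ j, n_j`, for all large `n`; here `n_i` is the number of
observations in the `i`-th block and `X_i` is its design matrix. -/
def SingularValueCondition {p : ℕ → ℕ} (x : (n : ℕ) → Fin n → Fin (p n) → ℝ)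
    (m : (n : ℕ) → Finset (Fin (p n))) : Prop :=
  ∃ a b : ℝ, 0 < a ∧ 0 < b ∧
    ∀ (K : ℕ) (u v : Fin K → ℝ), (∀ i, 0 ≤ u i ∧ u i < v i ∧ v i ≤ 1) →
      (Pairwise fun i j => Disjoint (Set.Ioc (u i) (v i)) (Set.Ioc (u j) (v j))) →
      ∀ᶠ n in atTop, ∀ i,
        let P : Fin K → Finset (Fin n) := fun j => timeBlock n (u j) (v j)
        let N : Fin K → ℝ := fun j => ((P j).card : ℝ)
        let G : Fin K → Matrix (m n) (m n) ℝ := fun j => gramMatrix (x n) (P j) (m n)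
        SingularValuesBetween (a * N i) (b * N i) (G i) ∧
        SingularValuesBetween (a * (N i / ∑ j, N j)) (b * (N i / ∑ j, N j))
          ((∑ j, G j)⁻¹ * G i)

end

/-!
Relative to the density `f*` of the true coefficients, the marginal likelihood of a model is an
integral of `exp (gain / σ2)` over its prior (`relativeLikelihood`), where the gain is a quadratic
polynomial in the differences between the coefficients of the model and the true ones.  The Bayes
factor is the quotient of two such integrals.  Intersecting the segments of the model with those of
the truth splits the observations into joint segments, on which both coefficient vectors are
constant; each of these is a block of consecutive time points, so the singular value condition
makes the quadratic part of the gain there comparable to `n` times the squared distance of the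
coefficient vectors (`SingularValueCondition.joint_quadratic_bounds`).

*The truth.*  On the cube of side `2 / √n` around the true coefficients the prior density is bounded
below, the quadratic part of the gain is bounded, and the linear part has average zero.  Hence the
relative likelihood of the true model is at least `(κ / √n) ^ ((l* + 1) |m*|)` for every response
(`le_relativeLikelihood_self`).

*The alternative.*  By Young's inequality the linear part of the gain is at most half of the
quadratic part plus the squared norm of the score divided by a multiple of `n`
(`gaussianGain_le_scoreSq`).  The expected squared norm of the score is `O(n w)`, with `w` the
number of covariates in either model, so by Markov's inequality the score contributes at most
`n ^ (w / 8)` to the likelihood, outside an event of probability `O(1 / log n)`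
(`responseLaw_scoreSq_ge_le`).  Outside that event there are two cases.

* If a true change point or a true covariate is missing from the model, the remaining half of the
  quadratic part is at least a multiple of `n` for all coefficients of the model
  (`energy_ge_of_missing_changePoint`, `energy_ge_of_missing_covariate`), and the exponential loss
  beats the factor `n ^ O(q)` because `q log n = o(n)` (`underfit_ratio_le`).  With fewer change
  points than the truth, this is always the case.
* Otherwise the model has more segments than the truth and contains all true covariates.  A
  Gaussian integral for each coefficient bounds its relative likelihood by
  `n ^ (w / 8) (K / √n) ^ ((l + 1) w)` (`relativeLikelihood_le_of_slab`).  It has at least `w` more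
  coefficients than the truth, so that the Bayes factor is at most `(A n ^ (-3/8)) ^ w` for a
  constant `A` (`overfit_ratio_le`).
-/

/-! ### Segments and their overlaps -/

/-- The left end point of the segment `j` of `(0, 1]`. -/
def segmentStart {l : ℕ} (t : Fin l → ℝ) : Fin (l + 1) → ℝ := Fin.cons 0 t

/-- The right end point of the segment `j` of `(0, 1]`. -/
def segmentEnd {l : ℕ} (t : Fin l → ℝ) : Fin (l + 1) → ℝ := Fin.snoc t 1

lemma segmentStart_nonneg {l : ℕ} {t : Fin l → ℝ} (ht : IsChangePoints t) (j : Fin (l + 1)) :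
    0 ≤ segmentStart t j := by
  refine Fin.cases ?_ (fun k => ?_) j
  · simp [segmentStart]
  · simpa [segmentStart] using (ht.2 k).1.le

lemma segmentEnd_le_one {l : ℕ} {t : Fin l → ℝ} (ht : IsChangePoints t) (j : Fin (l + 1)) :
    segmentEnd t j ≤ 1 := by
  refine Fin.lastCases ?_ (fun k => ?_) j
  · simp [segmentEnd]
  · simpa [segmentEnd] using (ht.2 k).2.le

lemma segmentEnd_le_segmentStart {l : ℕ} {t : Fin l → ℝ} (ht : IsChangePoints t)
    {j j' : Fin (l + 1)} (h : j < j') : segmentEnd t j ≤ segmentStart t j' := by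
  induction j using Fin.lastCases with
  | last => exact absurd h (not_lt.2 (Fin.le_last _))
  | cast k =>
    induction j' using Fin.cases with
    | zero => exact absurd h (not_lt.2 (Fin.zero_le _))
    | succ k' =>
      simp only [segmentEnd, segmentStart, Fin.snoc_castSucc, Fin.cons_succ]
      refine ht.1.monotone ?_
      rw [Fin.lt_def] at h
      rw [Fin.le_def]
      simp only [Fin.val_castSucc, Fin.val_succ] at h
      omega

lemma segment_unique {l : ℕ} {t : Fin l → ℝ} (ht : IsChangePoints t) {j j' : Fin (l + 1)} {s : ℝ}
    (h : segmentStart t j < s ∧ s ≤ segmentEnd t j)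
    (h' : segmentStart t j' < s ∧ s ≤ segmentEnd t j') : j = j' := by
  rcases lt_trichotomy j j' with hlt | heq | hlt
  · linarith [segmentEnd_le_segmentStart ht hlt]
  · exact heq
  · linarith [segmentEnd_le_segmentStart ht hlt]

open Classical in
/-- The number of change points before `s` is the number of the segment that contains `s`. -/
lemma mem_segment_card {l : ℕ} {t : Fin l → ℝ} (ht : IsChangePoints t) {s : ℝ} (hs : 0 < s)
    (hs1 : s ≤ 1) (j : Fin (l + 1)) (hj : j.val = (Finset.univ.filter fun k => t k < s).card) :
    segmentStart t j < s ∧ s ≤ segmentEnd t j := by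
  -- the change points before `s` form an initial segment of `Fin l`
  have key : ∀ k : Fin l, t k < s ↔ k.val < j.val := by
    intro k
    constructor
    · intro hk
      have : Finset.Iic k ⊆ Finset.univ.filter fun k => t k < s := fun k' hk' => by
        simpa using (ht.1.monotone (Finset.mem_Iic.1 hk')).trans_lt hk
      have := Finset.card_le_card this
      simp only [Fin.card_Iic] at this
      omega
    · intro hk
      by_contra hks
      have : (Finset.univ.filter fun k => t k < s) ⊆ Finset.Iio k := fun k' hk' => by
        rw [Finset.mem_Iio]
        by_contra hkk
        have h1 := ht.1.monotone (not_lt.1 hkk)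
        have h2 := (Finset.mem_filter.1 hk').2
        linarith
      have := Finset.card_le_card this
      simp only [Fin.card_Iio] at this
      omega
  constructor
  · induction j using Fin.cases with
    | zero => simpa [segmentStart] using hs
    | succ k => simpa [segmentStart] using (key k).2 (by simp)
  · induction j using Fin.lastCases with
    | last => simpa [segmentEnd] using hs1
    | cast k => simpa [segmentEnd] using mt (key k).1 (by simp)

lemma exists_mem_segment {l : ℕ} {t : Fin l → ℝ} (ht : IsChangePoints t) {s : ℝ} (hs : 0 < s)
    (hs1 : s ≤ 1) : ∃ j, segmentStart t j < s ∧ s ≤ segmentEnd t j := by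
  classical
  exact ⟨⟨(Finset.univ.filter fun k => t k < s).card,
    Nat.lt_succ_of_le ((Finset.card_le_univ _).trans (Fintype.card_fin l).le)⟩,
    mem_segment_card ht hs hs1 _ rfl⟩

lemma segmentIndex_eq_iff {l n : ℕ} {t : Fin l → ℝ} (ht : IsChangePoints t) (i : Fin n)
    (j : Fin (l + 1)) :
    segmentIndex n t i = j ↔
      (n : ℝ) * segmentStart t j < (i : ℝ) + 1 ∧ (i : ℝ) + 1 ≤ (n : ℝ) * segmentEnd t j := by
  have hn : (0 : ℝ) < n := by exact_mod_cast i.pos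
  have hi : (i : ℝ) + 1 ≤ n := by exact_mod_cast i.isLt
  set s : ℝ := ((i : ℝ) + 1) / n with hs
  have h1 : ∀ u : ℝ, (n : ℝ) * u < (i : ℝ) + 1 ↔ u < s := fun u => by
    rw [hs, lt_div_iff₀ hn, mul_comm]
  have h2 : ∀ u : ℝ, (i : ℝ) + 1 ≤ (n : ℝ) * u ↔ s ≤ u := fun u => by
    rw [hs, div_le_iff₀ hn, mul_comm]
  have hs0 : 0 < s := by positivity
  have hs1 : s ≤ 1 := by rw [hs, div_le_one hn]; exact hi
  rw [h1, h2]
  have hmem := mem_segment_card ht hs0 hs1 (segmentIndex n t i)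
    (by simp only [segmentIndex, h1])
  exact ⟨fun h => h ▸ hmem, fun h => segment_unique ht hmem h⟩

/-- The segment `j` of the change points `t` and the segment `j'` of the change points `t'` have an
interval in common. -/
def SegmentsOverlap {l l' : ℕ} (t : Fin l → ℝ) (t' : Fin l' → ℝ) (j : Fin (l + 1))
    (j' : Fin (l' + 1)) : Prop :=
  max (segmentStart t j) (segmentStart t' j') < min (segmentEnd t j) (segmentEnd t' j')

lemma segmentsOverlap_of_mem {l l' : ℕ} {t : Fin l → ℝ} {t' : Fin l' → ℝ} {j : Fin (l + 1)}
    {j' : Fin (l' + 1)} {s : ℝ} (h : segmentStart t j < s ∧ s ≤ segmentEnd t j)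
    (h' : segmentStart t' j' < s ∧ s ≤ segmentEnd t' j') : SegmentsOverlap t t' j j' :=
  (max_lt h.1 h'.1).trans_le (le_min h.2 h'.2)

lemma segmentStart_lt_segmentEnd {l : ℕ} {t : Fin l → ℝ} (ht : IsChangePoints t)
    (j : Fin (l + 1)) : segmentStart t j < segmentEnd t j := by
  induction j using Fin.cases with
  | zero =>
    cases l with
    | zero => simp [segmentStart, segmentEnd, Fin.snoc]
    | succ l => simpa [segmentStart, segmentEnd, Fin.snoc] using (ht.2 0).1
  | succ k =>
    by_cases h : k.val + 1 < l
    · have := ht.1 (show k < ⟨k.val + 1, h⟩ from by simp [Fin.lt_def])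
      simpa [segmentStart, segmentEnd, Fin.snoc, h, Fin.castLT] using this
    · simpa [segmentStart, segmentEnd, Fin.snoc, h] using (ht.2 k).2

/-- The segment of `t'` that contains the right end point of the segment `j` of `t` overlaps it. -/
lemma exists_segmentsOverlap_right {l l' : ℕ} {t : Fin l → ℝ} {t' : Fin l' → ℝ}
    (ht : IsChangePoints t) (ht' : IsChangePoints t') (j : Fin (l + 1)) :
    ∃ j', SegmentsOverlap t t' j j' := by
  have h := segmentStart_lt_segmentEnd ht j
  obtain ⟨j', hj'⟩ := exists_mem_segment ht' ((segmentStart_nonneg ht j).trans_lt h)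
    (segmentEnd_le_one ht j)
  exact ⟨j', segmentsOverlap_of_mem ⟨h, le_rfl⟩ hj'⟩

lemma exists_segmentsOverlap_left {l l' : ℕ} {t : Fin l → ℝ} {t' : Fin l' → ℝ}
    (ht : IsChangePoints t) (ht' : IsChangePoints t') (j' : Fin (l' + 1)) :
    ∃ j, SegmentsOverlap t t' j j' := by
  obtain ⟨j, hj⟩ := exists_segmentsOverlap_right ht' ht j'
  exact ⟨j, by rwa [SegmentsOverlap, max_comm, min_comm]⟩

/-- A change point of `t'` that is not one of `t` lies in the interior of a segment of `t`, which
therefore overlaps both adjacent segments of `t'`. -/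
lemma exists_segmentsOverlap_both {l l' : ℕ} {t : Fin l → ℝ} {t' : Fin l' → ℝ}
    (ht : IsChangePoints t) (ht' : IsChangePoints t') (k : Fin l') (hk : t' k ∉ Set.range t) :
    ∃ j, SegmentsOverlap t t' j k.castSucc ∧ SegmentsOverlap t t' j k.succ := by
  obtain ⟨j, hj⟩ := exists_mem_segment ht (ht'.2 k).1 (ht'.2 k).2.le
  refine ⟨j, segmentsOverlap_of_mem hj (s := t' k) ?_, ?_⟩
  · have := segmentStart_lt_segmentEnd ht' k.castSucc
    simp only [segmentEnd, Fin.snoc_castSucc] at this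
    simpa [segmentEnd] using this
  · have hlt : t' k < segmentEnd t j := by
      refine lt_of_le_of_ne hj.2 fun h => ?_
      induction j using Fin.lastCases with
      | last => simp [segmentEnd] at h; linarith [(ht'.2 k).2]
      | cast k' => simp [segmentEnd] at h; exact hk ⟨k', h.symm⟩
    have h2 := segmentStart_lt_segmentEnd ht' k.succ
    simp only [segmentStart, Fin.cons_succ] at h2
    unfold SegmentsOverlap
    simp only [segmentStart, Fin.cons_succ] at hj ⊢
    exact (max_le hj.1.le le_rfl).trans_lt (lt_min hlt h2)

open Classical in
/-- The observations in segment `j` of `t` and in segment `j'` of `t'`. -/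
noncomputable def jointSegment {l l' : ℕ} (n : ℕ) (t : Fin l → ℝ) (t' : Fin l' → ℝ)
    (j : Fin (l + 1)) (j' : Fin (l' + 1)) : Finset (Fin n) :=
  Finset.univ.filter fun i => segmentIndex n t i = j ∧ segmentIndex n t' i = j'

lemma jointSegment_eq_timeBlock {l l' : ℕ} (n : ℕ) {t : Fin l → ℝ} {t' : Fin l' → ℝ}
    (ht : IsChangePoints t) (ht' : IsChangePoints t') (j : Fin (l + 1)) (j' : Fin (l' + 1)) :
    jointSegment n t t' j j' = timeBlock n (max (segmentStart t j) (segmentStart t' j'))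
      (min (segmentEnd t j) (segmentEnd t' j')) := by
  ext i
  have hn : (0 : ℝ) ≤ n := Nat.cast_nonneg n
  simp only [jointSegment, timeBlock, Finset.mem_filter, Finset.mem_univ, true_and,
    segmentIndex_eq_iff ht, segmentIndex_eq_iff ht', mul_max_of_nonneg _ _ hn,
    mul_min_of_nonneg _ _ hn, max_lt_iff, le_min_iff]
  tauto

lemma jointSegment_eq_empty {l l' : ℕ} (n : ℕ) {t : Fin l → ℝ} {t' : Fin l' → ℝ}
    (ht : IsChangePoints t) (ht' : IsChangePoints t') {j : Fin (l + 1)} {j' : Fin (l' + 1)}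
    (h : ¬ SegmentsOverlap t t' j j') : jointSegment n t t' j j' = ∅ := by
  rw [jointSegment_eq_timeBlock n ht ht']
  refine Finset.filter_eq_empty_iff.2 fun i _ hi => ?_
  have := mul_le_mul_of_nonneg_left (not_lt.1 h) (Nat.cast_nonneg (α := ℝ) n)
  linarith [hi.1, hi.2]

/-- Summing over the observations is summing over the joint segments. -/
lemma sum_jointSegment {l l' n : ℕ} (t : Fin l → ℝ) (t' : Fin l' → ℝ) (f : Fin n → ℝ) :
    ∑ j, ∑ j', ∑ i ∈ jointSegment n t t' j j', f i = ∑ i, f i := by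
  classical
  rw [← Finset.sum_product', Finset.univ_product_univ,
    ← Finset.sum_fiberwise (s := Finset.univ)
      (g := fun i => (segmentIndex n t i, segmentIndex n t' i)) (f := f)]
  refine Finset.sum_congr rfl fun q _ => Finset.sum_congr ?_ fun _ _ => rfl
  ext i
  simp [jointSegment, Prod.ext_iff]

/-- The number of time indices in `(n u, n v]` is at least `n (v - u) - 1`. -/
lemma card_timeBlock_ge (n : ℕ) {u v : ℝ} (hu : 0 ≤ u) (hv : v ≤ 1) :
    (n : ℝ) * (v - u) - 1 ≤ (timeBlock n u v).card := by
  have hn : (0 : ℝ) ≤ n := Nat.cast_nonneg n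
  have hsub : Finset.Ico ⌊(n : ℝ) * u⌋₊ ⌊(n : ℝ) * v⌋₊ ⊆
      (timeBlock n u v).map Fin.valEmbedding := by
    intro a ha
    rw [Finset.mem_Ico] at ha
    have h2 : ((a + 1 : ℕ) : ℝ) ≤ n * v :=
      (Nat.le_floor_iff' (Nat.succ_ne_zero a)).1 ha.2
    have h1 : (n : ℝ) * u < (a : ℝ) + 1 := by
      have := Nat.lt_floor_add_one ((n : ℝ) * u)
      have h3 : ((⌊(n : ℝ) * u⌋₊ : ℕ) : ℝ) ≤ a := by exact_mod_cast ha.1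
      linarith
    push_cast at h2
    have h4 : a < n := by
      have : (n : ℝ) * v ≤ n := mul_le_of_le_one_right hn hv
      have : (a : ℝ) + 1 ≤ n := h2.trans this
      exact_mod_cast this
    exact Finset.mem_map.2 ⟨⟨a, h4⟩, by simp [timeBlock, h1, h2], rfl⟩
  have hc := Finset.card_le_card hsub
  rw [Nat.card_Ico, Finset.card_map] at hc
  have h5 : ((⌊(n : ℝ) * u⌋₊ : ℕ) : ℝ) ≤ n * u := Nat.floor_le (by positivity)
  have h6 := Nat.lt_floor_add_one ((n : ℝ) * v)
  have h7 : ((⌊(n : ℝ) * v⌋₊ : ℕ) : ℝ) ≤ (timeBlock n u v).card + (⌊(n : ℝ) * u⌋₊ : ℕ) := by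
    exact_mod_cast Nat.sub_le_iff_le_add.1 hc
  linarith

/-! ### Gram matrices as quadratic forms -/

lemma inner_toEuclideanLin_gramMatrix {n p : ℕ} (x : Fin n → Fin p → ℝ) (P : Finset (Fin n))
    (m : Finset (Fin p)) (h : EuclideanSpace ℝ m) :
    inner ℝ h (Matrix.toEuclideanLin (gramMatrix x P m) h) = ∑ i ∈ P, (∑ k : m, x i k * h k) ^ 2 := by
  rw [← Finset.sum_coe_sort P]
  have : inner ℝ h (Matrix.toEuclideanLin (gramMatrix x P m) h) =
      h.ofLp ⬝ᵥ (gramMatrix x P m).mulVec h.ofLp := by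
    simp [EuclideanSpace.inner_eq_star_dotProduct, Matrix.toLpLin_apply, dotProduct_comm]
  rw [this, gramMatrix, ← Matrix.mulVec_mulVec, Matrix.dotProduct_mulVec, Matrix.vecMul_transpose]
  simp [dotProduct, Matrix.mulVec, designMatrix, sq]

lemma isSymmetric_toEuclideanLin_gramMatrix {n p : ℕ} (x : Fin n → Fin p → ℝ)
    (P : Finset (Fin n)) (m : Finset (Fin p)) :
    (Matrix.toEuclideanLin (gramMatrix x P m)).IsSymmetric := by
  rw [Matrix.isSymmetric_toEuclideanLin_iff]
  simp [Matrix.IsHermitian, gramMatrix, Matrix.conjTranspose_eq_transpose_of_trivial]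

/-- The eigenvalues of a Gram matrix are nonnegative, so they are its singular values, and the
quadratic form of the matrix lies between the bounds on the latter. -/
lemma gramMatrix_quadratic_bounds {n p : ℕ} (x : Fin n → Fin p → ℝ) (P : Finset (Fin n))
    (m : Finset (Fin p)) {lo hi : ℝ} (hG : SingularValuesBetween lo hi (gramMatrix x P m))
    (h : m → ℝ) :
    lo * ∑ k, h k ^ 2 ≤ ∑ i ∈ P, (∑ k : m, x i k * h k) ^ 2 ∧
      ∑ i ∈ P, (∑ k : m, x i k * h k) ^ 2 ≤ hi * ∑ k, h k ^ 2 := by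
  set T := Matrix.toEuclideanLin (gramMatrix x P m) with hT
  have hsym : T.IsSymmetric := isSymmetric_toEuclideanLin_gramMatrix x P m
  have hd : Module.finrank ℝ (EuclideanSpace ℝ m) = Fintype.card m := finrank_euclideanSpace
  set v := hsym.eigenvectorBasis hd with hv
  set μ := hsym.eigenvalues hd with hμ
  have hTv : ∀ r, T (v r) = μ r • v r := fun r => by
    exact hsym.apply_eigenvectorBasis hd r
  have hμ0 : ∀ r, 0 ≤ μ r := fun r => by
    have h1 : 0 ≤ inner ℝ (v r) (T (v r)) := by
      rw [hT, inner_toEuclideanLin_gramMatrix]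
      exact Finset.sum_nonneg fun _ _ => sq_nonneg _
    rwa [hTv, inner_smul_right, real_inner_self_eq_norm_sq, v.orthonormal.1, one_pow,
      mul_one] at h1
  have hbd : ∀ r, lo ≤ μ r ∧ μ r ≤ hi := fun r => by
    have hev : Module.End.HasEigenvalue (T.adjoint ∘ₗ T) ((μ r ^ 2 : ℝ) : ℝ) := by
      refine Module.End.hasEigenvalue_of_hasEigenvector (x := v r) ⟨?_, v.orthonormal.ne_zero r⟩
      rw [Module.End.mem_eigenspace_iff, hsym.adjoint_eq, LinearMap.comp_apply, hTv, map_smul, hTv,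
        smul_smul, sq]
    obtain ⟨r', hr'⟩ := T.isSymmetric_adjoint_comp_self.exists_eigenvalues_eq hd hev
    have hs := T.singularValues_fin hd r'
    have h2 : T.isSymmetric_adjoint_comp_self.eigenvalues hd r' = μ r ^ 2 := by simpa using hr'
    rw [h2, Real.sqrt_sq (hμ0 r)] at hs
    have := hG r' r'.isLt
    rw [← hT, hs] at this
    exact ⟨this.1.le, this.2.le⟩
  set g : EuclideanSpace ℝ m := WithLp.toLp 2 h with hg
  have hq : ∑ i ∈ P, (∑ k : m, x i k * h k) ^ 2 = ∑ r, μ r * inner ℝ g (v r) ^ 2 := by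
    have h1 := inner_toEuclideanLin_gramMatrix x P m g
    rw [← hT] at h1
    have h2 : ∑ i ∈ P, (∑ k : m, x i k * h k) ^ 2 = inner ℝ g (T g) := by rw [h1]
    rw [h2, ← v.sum_inner_mul_inner]
    refine Finset.sum_congr rfl fun r _ => ?_
    rw [← hsym, hTv, real_inner_smul_left, real_inner_comm]
    ring
  have hn : ∑ k, h k ^ 2 = ∑ r, inner ℝ g (v r) ^ 2 := by
    have h1 : ∑ k, h k ^ 2 = inner ℝ g g := by
      rw [real_inner_self_eq_norm_sq, EuclideanSpace.norm_sq_eq]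
      simp [hg]
    rw [h1, ← v.sum_inner_mul_inner]
    exact Finset.sum_congr rfl fun r _ => by rw [real_inner_comm g (v r), sq]
  rw [hq, hn, Finset.mul_sum, Finset.mul_sum]
  exact ⟨Finset.sum_le_sum fun r _ => mul_le_mul_of_nonneg_right (hbd r).1 (sq_nonneg _),
    Finset.sum_le_sum fun r _ => mul_le_mul_of_nonneg_right (hbd r).2 (sq_nonneg _)⟩

/-- On every joint segment that contains an interval, the design restricted to the covariates `m`
is, up to constants, an isometry scaled by `√n`.  Only families of a single block enter. -/
lemma SingularValueCondition.joint_quadratic_bounds {p : ℕ → ℕ}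
    {x : (n : ℕ) → Fin n → Fin (p n) → ℝ} {m : (n : ℕ) → Finset (Fin (p n))}
    (hA6 : SingularValueCondition x m) {l l' : ℕ} {t : Fin l → ℝ} {t' : Fin l' → ℝ}
    (ht : IsChangePoints t) (ht' : IsChangePoints t') :
    ∃ a b : ℝ, 0 < a ∧ 0 < b ∧ ∀ᶠ n : ℕ in atTop, ∀ (j : Fin (l + 1)) (j' : Fin (l' + 1))
      (h : Fin (p n) → ℝ), (∀ k ∉ m n, h k = 0) → SegmentsOverlap t t' j j' →
        a * n * ∑ k, h k ^ 2 ≤ ∑ i ∈ jointSegment n t t' j j', (∑ k, x n i k * h k) ^ 2 ∧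
        ∑ i ∈ jointSegment n t t' j j', (∑ k, x n i k * h k) ^ 2 ≤ b * n * ∑ k, h k ^ 2 := by
  classical
  obtain ⟨a, b, ha, hb, H⟩ := hA6
  let u : Fin (l + 1) × Fin (l' + 1) → ℝ := fun q =>
    max (segmentStart t q.1) (segmentStart t' q.2)
  let v : Fin (l + 1) × Fin (l' + 1) → ℝ := fun q => min (segmentEnd t q.1) (segmentEnd t' q.2)
  obtain ⟨q₀, hq₀⟩ := Finite.exists_min fun q => if u q < v q then v q - u q else 1
  set ρ : ℝ := if u q₀ < v q₀ then v q₀ - u q₀ else 1 with hρ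
  have hρ0 : 0 < ρ := by
    rw [hρ]; split_ifs with h
    · linarith
    · norm_num
  refine ⟨a * (ρ / 2), b, by positivity, hb, ?_⟩
  have hev : ∀ᶠ n : ℕ in atTop, ∀ q : Fin (l + 1) × Fin (l' + 1), u q < v q →
      SingularValuesBetween (a * (timeBlock n (u q) (v q)).card)
        (b * (timeBlock n (u q) (v q)).card)
        (gramMatrix (x n) (timeBlock n (u q) (v q)) (m n)) := by
    refine eventually_all.2 fun q => ?_
    by_cases hq : u q < v q
    · have h1 := H 1 (fun _ => u q) (fun _ => v q)
        (fun _ => ⟨le_max_of_le_left (segmentStart_nonneg ht _), hq,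
          min_le_of_left_le (segmentEnd_le_one ht _)⟩)
        (fun i j hij => absurd (Subsingleton.elim i j) hij)
      filter_upwards [h1] with n hn _
      exact (hn 0).1
    · exact Eventually.of_forall fun _ h => absurd h hq
  filter_upwards [hev, eventually_ge_atTop ⌈2 / ρ⌉₊] with n hn hnρ j j' h hh hov
  have hq : u (j, j') < v (j, j') := hov
  have hnρ' : 2 ≤ n * ρ := by
    have := (Nat.le_ceil (2 / ρ)).trans (Nat.cast_le.2 hnρ)
    rwa [div_le_iff₀ hρ0] at this
  have hρq : ρ ≤ v (j, j') - u (j, j') := by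
    have := hq₀ (j, j')
    simp only [if_pos hq] at this
    exact this
  have hcard := card_timeBlock_ge n (le_max_of_le_left (segmentStart_nonneg ht j) : 0 ≤ u (j, j'))
    (min_le_of_left_le (segmentEnd_le_one ht j) : v (j, j') ≤ 1)
  have hn0 : (0 : ℝ) ≤ n := Nat.cast_nonneg n
  have hlow : n * (ρ / 2) ≤ ((timeBlock n (u (j, j')) (v (j, j'))).card : ℝ) := by
    have := mul_le_mul_of_nonneg_left hρq hn0
    linarith
  have hup : ((timeBlock n (u (j, j')) (v (j, j'))).card : ℝ) ≤ n := by
    exact_mod_cast (Finset.card_le_univ _).trans (Fintype.card_fin n).le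
  have hJ : jointSegment n t t' j j' = timeBlock n (u (j, j')) (v (j, j')) :=
    jointSegment_eq_timeBlock n ht ht' j j'
  have hsq : ∑ k, h k ^ 2 = ∑ k : m n, h k ^ 2 := by
    rw [Finset.sum_coe_sort (m n) (fun k => h k ^ 2)]
    exact (Finset.sum_subset (Finset.subset_univ _) fun k _ hk => by simp [hh k hk]).symm
  have hlin : ∀ i, ∑ k, x n i k * h k = ∑ k : m n, x n i k * h k := fun i => by
    rw [Finset.sum_coe_sort (m n) (fun k => x n i k * h k)]
    exact (Finset.sum_subset (Finset.subset_univ _) fun k _ hk => by simp [hh k hk]).symm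
  have hb2 := gramMatrix_quadratic_bounds _ _ _ (hn (j, j') hq) (fun k => h k)
  have hS : 0 ≤ ∑ k : m n, h k ^ 2 := Finset.sum_nonneg fun _ _ => sq_nonneg _
  simp only [hJ, hsq, hlin]
  refine ⟨le_trans (mul_le_mul_of_nonneg_right ?_ hS) hb2.1,
    hb2.2.trans (mul_le_mul_of_nonneg_right ?_ hS)⟩
  · have := mul_le_mul_of_nonneg_left hlow ha.le
    linarith
  · exact mul_le_mul_of_nonneg_left hup hb.le

/-! ### The noise -/

lemma integral_sq_linear_gaussian {n : ℕ} (μ : Fin n → ℝ) (σ2 : ℝ≥0) (c : Fin n → ℝ) :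
    Integrable (fun y => (∑ i, c i * (y i - μ i)) ^ 2)
        (Measure.pi fun i => gaussianReal (μ i) σ2) ∧
      ∫ y, (∑ i, c i * (y i - μ i)) ^ 2 ∂(Measure.pi fun i => gaussianReal (μ i) σ2) =
        σ2 * ∑ i, c i ^ 2 := by
  set P := Measure.pi fun i => gaussianReal (μ i) σ2
  have hmem1 : ∀ i, MemLp (fun s : ℝ => c i * (s - μ i)) 2 (gaussianReal (μ i) σ2) := fun i =>
    ((memLp_id_gaussianReal 2).sub (memLp_const (μ i))).const_mul (c i)
  have hmem : ∀ i, MemLp (fun y : Fin n → ℝ => c i * (y i - μ i)) 2 P := fun i =>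
    (hmem1 i).comp_measurePreserving (measurePreserving_eval _ i)
  have hsum : MemLp (fun y : Fin n → ℝ => ∑ i, c i * (y i - μ i)) 2 P :=
    memLp_finsetSum _ fun i _ => hmem i
  refine ⟨hsum.integrable_sq, ?_⟩
  have hint : ∀ i, ∫ y, c i * (y i - μ i) ∂P = 0 := fun i => by
    rw [integral_comp_eval (μ := fun i => gaussianReal (μ i) σ2) (i := i)
      (f := fun s : ℝ => c i * (s - μ i)) (by fun_prop), integral_const_mul,
      integral_sub (f := fun s : ℝ => s) ((memLp_id_gaussianReal 1).integrable (by simp))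
        (integrable_const _)]
    simp
  have h0 : ∫ y, ∑ i, c i * (y i - μ i) ∂P = 0 := by
    rw [integral_finsetSum _ fun i _ => (hmem i).integrable (by simp)]
    simp [hint]
  have hvar := variance_sum_pi (μ := fun i => gaussianReal (μ i) σ2)
    (X := fun i s => c i * (s - μ i)) hmem1
  rw [show (∑ i, fun ω : Fin n → ℝ => c i * (ω i - μ i)) = fun y => ∑ i, c i * (y i - μ i) by
    ext; simp, variance_of_integral_eq_zero hsum.aestronglyMeasurable.aemeasurable h0] at hvar
  rw [hvar, Finset.mul_sum]
  refine Finset.sum_congr rfl fun i _ => ?_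
  rw [variance_const_mul, variance_sub_const (by fun_prop), variance_fun_id_gaussianReal]
  ring

/-- The inner product of the covariate `k` with `e` over the joint segment `(j, j')`: the score of
this coefficient if `e` is the vector of residuals. -/
noncomputable def blockScore {n p l l' : ℕ} (x : Fin n → Fin p → ℝ) (t : Fin l → ℝ)
    (t' : Fin l' → ℝ) (e : Fin n → ℝ) (j : Fin (l + 1)) (j' : Fin (l' + 1)) (k : Fin p) : ℝ :=
  ∑ i ∈ jointSegment n t t' j j', x i k * e i

/-- The squared norm of the scores of the covariates in `w` on all joint segments. -/
noncomputable def scoreSq {n p l l' : ℕ} (x : Fin n → Fin p → ℝ) (t : Fin l → ℝ)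
    (t' : Fin l' → ℝ) (w : Finset (Fin p)) (e : Fin n → ℝ) : ℝ :=
  ∑ j, ∑ j', ∑ k ∈ w, blockScore x t t' e j j' k ^ 2

/-- Markov's inequality for the score, whose expectation is at most of order `n` times the number of
covariates because the covariates are bounded. -/
lemma responseLaw_scoreSq_ge_le {n p l l' lstar : ℕ} (x : Fin n → Fin p → ℝ) (σ2 : ℝ≥0)
    (tstar : Fin lstar → ℝ) (βstar : Fin (lstar + 1) → Fin p → ℝ) (t : Fin l → ℝ)
    (t' : Fin l' → ℝ) (w : Finset (Fin p)) {K : ℝ} (hK : ∀ i k, |x i k| ≤ K) {s : ℝ}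
    (hs : 0 < s) :
    responseLaw x σ2 tstar βstar
        {y | s ≤ scoreSq x t t' w fun i => y i - regressionMean x tstar βstar i} ≤
      ENNReal.ofReal (σ2 * K ^ 2 * n * w.card / s) := by
  classical
  set μ := regressionMean x tstar βstar with hμ
  set P := responseLaw x σ2 tstar βstar with hP
  have : IsProbabilityMeasure P := by rw [hP]; unfold responseLaw; infer_instance
  have hterm : ∀ (j : Fin (l + 1)) (j' : Fin (l' + 1)) (k : Fin p),
      Integrable (fun y => (∑ i ∈ jointSegment n t t' j j', x i k * (y i - μ i)) ^ 2) P ∧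
      ∫ y, (∑ i ∈ jointSegment n t t' j j', x i k * (y i - μ i)) ^ 2 ∂P =
        σ2 * ∑ i ∈ jointSegment n t t' j j', x i k ^ 2 := by
    intro j j' k
    have := integral_sq_linear_gaussian μ σ2
      (fun i => if i ∈ jointSegment n t t' j j' then x i k else 0)
    rw [show P = Measure.pi fun i => gaussianReal (μ i) σ2 from rfl]
    simpa [ite_mul, Finset.sum_ite_mem, ite_pow] using this
  have hint : Integrable (fun y => scoreSq x t t' w fun i => y i - μ i) P :=
    integrable_finsetSum _ fun j _ => integrable_finsetSum _ fun j' _ =>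
      integrable_finsetSum _ fun k _ => (hterm j j' k).1
  have hnn : ∀ y : Fin n → ℝ, 0 ≤ scoreSq x t t' w fun i => y i - μ i := fun y =>
    Finset.sum_nonneg fun j _ => Finset.sum_nonneg fun j' _ =>
      Finset.sum_nonneg fun k _ => sq_nonneg _
  have hE : ∫ y, scoreSq x t t' w (fun i => y i - μ i) ∂P ≤ σ2 * K ^ 2 * n * w.card := by
    unfold scoreSq blockScore
    rw [integral_finsetSum _ fun j _ => integrable_finsetSum _ fun j' _ =>
      integrable_finsetSum _ fun k _ => (hterm j j' k).1]
    simp_rw [integral_finsetSum _ fun j' _ =>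
      integrable_finsetSum _ fun k _ => (hterm _ j' k).1,
      integral_finsetSum _ fun k _ => (hterm _ _ k).1, (hterm _ _ _).2]
    have : ∀ j j', ∑ k ∈ w, (σ2 : ℝ) * ∑ i ∈ jointSegment n t t' j j', x i k ^ 2 =
        ∑ i ∈ jointSegment n t t' j j', (σ2 : ℝ) * ∑ k ∈ w, x i k ^ 2 := fun j j' => by
      rw [← Finset.mul_sum, Finset.sum_comm, ← Finset.mul_sum]
    simp_rw [this]
    rw [sum_jointSegment]
    calc ∑ i, (σ2 : ℝ) * ∑ k ∈ w, x i k ^ 2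
        ≤ ∑ i : Fin n, (σ2 : ℝ) * ∑ k ∈ w, K ^ 2 := by
          refine Finset.sum_le_sum fun i _ => mul_le_mul_of_nonneg_left
            (Finset.sum_le_sum fun k _ => ?_) σ2.coe_nonneg
          exact sq_le_sq' (by linarith [neg_abs_le (x i k), hK i k])
            ((le_abs_self _).trans (hK i k))
      _ = σ2 * K ^ 2 * n * w.card := by simp; ring
  have hM := mul_meas_ge_le_integral_of_nonneg (ae_of_all P hnn) hint s
  rw [ENNReal.le_ofReal_iff_toReal_le (measure_ne_top _ _) (by positivity), le_div_iff₀ hs,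
    mul_comm]
  exact hM.trans hE

/-! ### The prior -/

instance isProbabilityMeasure_spikeSlab (V : ℝ≥0) (P : Prop) [Decidable P] :
    IsProbabilityMeasure (if P then gaussianReal 0 V else Measure.dirac 0) := by
  split_ifs <;> infer_instance

instance isProbabilityMeasure_coefficientPrior (l p : ℕ) (V : ℝ≥0) (m : Finset (Fin p)) :
    IsProbabilityMeasure (coefficientPrior l p V m) := by
  unfold coefficientPrior; infer_instance

lemma coefficientPrior_ae_eq_zero (l p : ℕ) (V : ℝ≥0) (m : Finset (Fin p)) :
    ∀ᵐ β ∂coefficientPrior l p V m, ∀ j, ∀ k ∉ m, β j k = 0 := by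
  rw [ae_all_iff]
  intro j
  have h1 : ∀ᵐ b ∂(Measure.pi fun k : Fin p =>
      if k ∈ m then gaussianReal 0 V else Measure.dirac (0 : ℝ)), ∀ k ∉ m, b k = 0 := by
    rw [ae_all_iff]
    intro k
    have h2 : ∀ᵐ s ∂(if k ∈ m then gaussianReal 0 V else Measure.dirac (0 : ℝ)),
        k ∉ m → s = 0 := by
      by_cases hk : k ∈ m
      · exact ae_of_all _ fun _ h => absurd hk h
      · rw [if_neg hk, ae_dirac_eq]
        exact fun _ => rfl
    exact (measurePreserving_eval (fun k : Fin p =>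
      if k ∈ m then gaussianReal 0 V else Measure.dirac (0 : ℝ)) k).quasiMeasurePreserving.ae h2
  exact (measurePreserving_eval (fun _ : Fin (l + 1) => Measure.pi fun k : Fin p =>
      if k ∈ m then gaussianReal 0 V else Measure.dirac (0 : ℝ)) j).quasiMeasurePreserving.ae h1

lemma integral_prod_coefficientPrior {l p : ℕ} (V : ℝ≥0) (m : Finset (Fin p))
    (f : Fin (l + 1) → Fin p → ℝ → ℝ) :
    ∫ β, ∏ j, ∏ k, f j k (β j k) ∂coefficientPrior l p V m =
      ∏ j, ∏ k, ∫ s, f j k s ∂(if k ∈ m then gaussianReal 0 V else Measure.dirac 0) := by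
  rw [coefficientPrior,
    integral_fintype_prod_eq_prod (fun (j : Fin (l + 1)) (b : Fin p → ℝ) => ∏ k, f j k (b k))]
  exact Finset.prod_congr rfl fun j _ => integral_fintype_prod_eq_prod _

lemma integrable_prod_coefficientPrior {l p : ℕ} (V : ℝ≥0) (m : Finset (Fin p))
    {f : Fin (l + 1) → Fin p → ℝ → ℝ}
    (hf : ∀ j k, Integrable (f j k) (if k ∈ m then gaussianReal 0 V else Measure.dirac 0)) :
    Integrable (fun β => ∏ j, ∏ k, f j k (β j k)) (coefficientPrior l p V m) :=
  Integrable.fintype_prod (f := fun (j : Fin (l + 1)) (b : Fin p → ℝ) => ∏ k, f j k (b k))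
    fun j => Integrable.fintype_prod (hf j)

/-! ### The likelihood relative to the truth -/

/-- `σ2` times the log-likelihood ratio of the coefficients `β` against the true ones, in terms of
the residuals `e i` and the differences `d i` of the means. -/
noncomputable def gaussianGain {n : ℕ} (e d : Fin n → ℝ) : ℝ := ∑ i, (e i * d i - d i ^ 2 / 2)

lemma prod_gaussianPDFReal_eq {n : ℕ} (μ μ' y : Fin n → ℝ) {σ2 : ℝ≥0} (hσ2 : 0 < σ2) :
    ∏ i, gaussianPDFReal (μ i) σ2 (y i) = (∏ i, gaussianPDFReal (μ' i) σ2 (y i)) *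
      Real.exp (gaussianGain (fun i => y i - μ' i) (fun i => μ i - μ' i) / σ2) := by
  have hσ : (σ2 : ℝ) ≠ 0 := by exact_mod_cast hσ2.ne'
  rw [gaussianGain, Finset.sum_div, Real.exp_sum, ← Finset.prod_mul_distrib]
  refine Finset.prod_congr rfl fun i _ => ?_
  rw [gaussianPDFReal, gaussianPDFReal, mul_assoc _ _ (Real.exp _), ← Real.exp_add]
  congr 2
  field_simp
  ring

lemma gaussianGain_le {n : ℕ} (e d : Fin n → ℝ) : gaussianGain e d ≤ ∑ i, e i ^ 2 / 2 :=
  Finset.sum_le_sum fun i _ => by nlinarith [sq_nonneg (e i - d i)]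

/-- The marginal likelihood of a model, divided by the likelihood of the true coefficients. -/
noncomputable def relativeLikelihood {n p l l' : ℕ} (x : Fin n → Fin p → ℝ) (σ2 V : ℝ≥0)
    (t : Fin l → ℝ) (m : Finset (Fin p)) (t' : Fin l' → ℝ) (β' : Fin (l' + 1) → Fin p → ℝ)
    (y : Fin n → ℝ) : ℝ :=
  ∫ β, Real.exp (gaussianGain (fun i => y i - regressionMean x t' β' i)
    (fun i => regressionMean x t β i - regressionMean x t' β' i) / σ2) ∂(coefficientPrior l p V m)

lemma marginalLikelihood_eq_mul_relativeLikelihood {n p l l' : ℕ} (x : Fin n → Fin p → ℝ)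
    {σ2 : ℝ≥0} (hσ2 : 0 < σ2) (V : ℝ≥0) (t : Fin l → ℝ) (m : Finset (Fin p)) (t' : Fin l' → ℝ)
    (β' : Fin (l' + 1) → Fin p → ℝ) (y : Fin n → ℝ) :
    marginalLikelihood x σ2 V t m y =
      (∏ i, gaussianPDFReal (regressionMean x t' β' i) σ2 (y i)) *
        relativeLikelihood x σ2 V t m t' β' y := by
  rw [marginalLikelihood, relativeLikelihood, ← integral_const_mul]
  exact integral_congr_ae (ae_of_all _ fun β => prod_gaussianPDFReal_eq _ _ _ hσ2)

lemma relativeLikelihood_nonneg {n p l l' : ℕ} (x : Fin n → Fin p → ℝ) (σ2 V : ℝ≥0)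
    (t : Fin l → ℝ) (m : Finset (Fin p)) (t' : Fin l' → ℝ) (β' : Fin (l' + 1) → Fin p → ℝ)
    (y : Fin n → ℝ) : 0 ≤ relativeLikelihood x σ2 V t m t' β' y :=
  integral_nonneg fun _ => (Real.exp_pos _).le

lemma abs_bayesFactor_eq {n p l l' : ℕ} (x : Fin n → Fin p → ℝ) {σ2 : ℝ≥0} (hσ2 : 0 < σ2)
    (V : ℝ≥0) (t : Fin l → ℝ) (m : Finset (Fin p)) (t' : Fin l' → ℝ) (m' : Finset (Fin p))
    (β' : Fin (l' + 1) → Fin p → ℝ) (y : Fin n → ℝ) :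
    |bayesFactor x σ2 V t m t' m' y| =
      relativeLikelihood x σ2 V t m t' β' y / relativeLikelihood x σ2 V t' m' t' β' y := by
  have hpos : (∏ i, gaussianPDFReal (regressionMean x t' β' i) σ2 (y i)) ≠ 0 :=
    Finset.prod_ne_zero_iff.2 fun i _ => (gaussianPDFReal_pos _ _ _ hσ2.ne').ne'
  rw [bayesFactor, marginalLikelihood_eq_mul_relativeLikelihood x hσ2 V t m t' β',
    marginalLikelihood_eq_mul_relativeLikelihood x hσ2 V t' m' t' β', mul_div_mul_left _ _ hpos,
    abs_of_nonneg (div_nonneg (relativeLikelihood_nonneg ..) (relativeLikelihood_nonneg ..))]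

lemma integrable_exp_gaussianGain {n p l : ℕ} (x : Fin n → Fin p → ℝ) (σ2 V : ℝ≥0)
    (t : Fin l → ℝ) (m : Finset (Fin p)) (e μ : Fin n → ℝ) :
    Integrable (fun β => Real.exp (gaussianGain e (fun i => regressionMean x t β i - μ i) / σ2))
      (coefficientPrior l p V m) := by
  refine Integrable.of_bound (Continuous.aestronglyMeasurable ?_)
    (Real.exp ((∑ i, e i ^ 2 / 2) / σ2)) (ae_of_all _ fun β => ?_)
  · unfold gaussianGain regressionMean
    fun_prop
  · rw [Real.norm_of_nonneg (Real.exp_pos _).le, Real.exp_le_exp]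
    exact div_le_div_of_nonneg_right (gaussianGain_le _ _) σ2.coe_nonneg

/-- The squared difference of the mean vectors given by the coefficients `β` and `β'`, on the joint
segment `(j, j')`. -/
noncomputable def blockEnergy {n p l l' : ℕ} (x : Fin n → Fin p → ℝ) (t : Fin l → ℝ)
    (t' : Fin l' → ℝ) (β : Fin (l + 1) → Fin p → ℝ) (β' : Fin (l' + 1) → Fin p → ℝ)
    (j : Fin (l + 1)) (j' : Fin (l' + 1)) : ℝ :=
  ∑ i ∈ jointSegment n t t' j j', (∑ k, x i k * (β j k - β' j' k)) ^ 2

/-- On a joint segment both coefficient vectors are constant, so the gain is a quadratic polynomial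
in their differences. -/
lemma gaussianGain_eq_sum_blocks {n p l l' : ℕ} (x : Fin n → Fin p → ℝ) (t : Fin l → ℝ)
    (t' : Fin l' → ℝ) (e : Fin n → ℝ) (β : Fin (l + 1) → Fin p → ℝ)
    (β' : Fin (l' + 1) → Fin p → ℝ) :
    gaussianGain e (fun i => regressionMean x t β i - regressionMean x t' β' i) =
      ∑ j, ∑ j', (∑ k, blockScore x t t' e j j' k * (β j k - β' j' k) -
        blockEnergy x t t' β β' j j' / 2) := by
  rw [gaussianGain, ← sum_jointSegment t t']
  refine Finset.sum_congr rfl fun j _ => Finset.sum_congr rfl fun j' _ => ?_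
  have h1 : ∑ k, blockScore x t t' e j j' k * (β j k - β' j' k) =
      ∑ i ∈ jointSegment n t t' j j', e i * ∑ k, x i k * (β j k - β' j' k) := by
    simp_rw [blockScore, Finset.sum_mul, Finset.mul_sum]
    rw [Finset.sum_comm]
    exact Finset.sum_congr rfl fun i _ => Finset.sum_congr rfl fun k _ => by ring
  rw [h1, blockEnergy, Finset.sum_div, ← Finset.sum_sub_distrib]
  refine Finset.sum_congr rfl fun i hi => ?_
  have hi' := (Finset.mem_filter.1 hi).2
  have h2 : regressionMean x t β i - regressionMean x t' β' i =
      ∑ k, x i k * (β j k - β' j' k) := by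
    rw [regressionMean, regressionMean, hi'.1, hi'.2, ← Finset.sum_sub_distrib]
    exact Finset.sum_congr rfl fun k _ => by ring
  simp only [h2]

/-! ### The one-dimensional integrals -/

/-- Bounding the slab density by its maximum leaves a Gaussian integral. -/
lemma integral_exp_slab_le {V : ℝ≥0} {v₀ : ℝ} (hv₀ : 0 < v₀) (hV : v₀ ≤ V) {c : ℝ} (hc : 0 < c)
    (b : ℝ) :
    Integrable (fun s => Real.exp (-c * (s - b) ^ 2)) (gaussianReal 0 V) ∧
    ∫ s, Real.exp (-c * (s - b) ^ 2) ∂gaussianReal 0 V ≤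
      (√(2 * Real.pi * v₀))⁻¹ * √(Real.pi / c) := by
  have hVpos : (0 : ℝ) < V := hv₀.trans_le hV
  have hV0 : V ≠ 0 := by rintro rfl; simp at hVpos
  have hI : Integrable (fun s : ℝ => Real.exp (-c * (s - b) ^ 2)) :=
    (integrable_exp_neg_mul_sq hc).comp_sub_right b
  constructor
  · refine Integrable.of_bound (Continuous.aestronglyMeasurable (by fun_prop)) 1
      (ae_of_all _ fun s => ?_)
    rw [Real.norm_of_nonneg (Real.exp_pos _).le, Real.exp_le_one_iff]
    nlinarith [sq_nonneg (s - b)]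
  · rw [integral_gaussianReal_eq_integral_smul hV0]
    have hg : ∫ s : ℝ, Real.exp (-c * (s - b) ^ 2) = √(Real.pi / c) := by
      rw [integral_sub_right_eq_self (fun s => Real.exp (-c * s ^ 2)) b, integral_gaussian]
    rw [← hg, ← integral_const_mul]
    refine integral_mono_of_nonneg
      (ae_of_all _ fun s => mul_nonneg (gaussianPDFReal_nonneg _ _ _) (Real.exp_pos _).le)
      (hI.const_mul _) (ae_of_all _ fun s => ?_)
    refine mul_le_mul_of_nonneg_right ?_ (Real.exp_pos _).le
    rw [gaussianPDFReal]
    calc (√(2 * Real.pi * V))⁻¹ * Real.exp (-(s - 0) ^ 2 / (2 * V))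
        ≤ (√(2 * Real.pi * V))⁻¹ * 1 := by
          refine mul_le_mul_of_nonneg_left (Real.exp_le_one_iff.2 ?_) (by positivity)
          exact div_nonpos_of_nonpos_of_nonneg (by nlinarith [sq_nonneg (s - 0)]) (by positivity)
      _ ≤ (√(2 * Real.pi * v₀))⁻¹ := by
          rw [mul_one]
          exact inv_anti₀ (by positivity) (Real.sqrt_le_sqrt (by gcongr))

/-- On the interval of radius `r` around `b` the slab density is bounded below, the quadratic term
is at most `c * r ^ 2`, and the linear term averages to zero, whatever its slope `z`. -/
lemma le_integral_exp_slab {V : ℝ≥0} {v₀ v₁ : ℝ} (hv₀ : 0 < v₀) (hV : v₀ ≤ V) (hV1 : V ≤ v₁)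
    {c : ℝ} (hc : 0 < c) {b C r : ℝ} (hb : |b| ≤ C) (hr : 0 < r) (hr1 : r ≤ 1) (z : ℝ) :
    Integrable (fun s => Real.exp (z * (s - b) - c * (s - b) ^ 2)) (gaussianReal 0 V) ∧
    (√(2 * Real.pi * v₁))⁻¹ * Real.exp (-(C + 1) ^ 2 / (2 * v₀)) * Real.exp (-c * r ^ 2) *
        (2 * r) ≤
      ∫ s, Real.exp (z * (s - b) - c * (s - b) ^ 2) ∂gaussianReal 0 V := by
  have hVpos : (0 : ℝ) < V := hv₀.trans_le hV
  have hV0 : V ≠ 0 := by rintro rfl; simp at hVpos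
  have hI : Integrable (fun s => Real.exp (z * (s - b) - c * (s - b) ^ 2)) (gaussianReal 0 V) := by
    refine Integrable.of_bound (Continuous.aestronglyMeasurable (by fun_prop))
      (Real.exp (z ^ 2 / (4 * c))) (ae_of_all _ fun s => ?_)
    rw [Real.norm_of_nonneg (Real.exp_pos _).le, Real.exp_le_exp, le_div_iff₀ (by positivity)]
    nlinarith [sq_nonneg (z - 2 * c * (s - b))]
  refine ⟨hI, ?_⟩
  set κ := (√(2 * Real.pi * v₁))⁻¹ * Real.exp (-(C + 1) ^ 2 / (2 * v₀)) * Real.exp (-c * r ^ 2)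
  have hκ : 0 ≤ κ := by positivity
  have hI' : Integrable (fun s =>
      gaussianPDFReal 0 V s * Real.exp (z * (s - b) - c * (s - b) ^ 2)) := by
    rw [gaussianReal_of_var_ne_zero _ hV0, integrable_withDensity_iff_integrable_smul'
      (measurable_gaussianPDF 0 V) (ae_of_all _ fun _ => gaussianPDF_lt_top)] at hI
    simpa [toReal_gaussianPDF] using hI
  rw [integral_gaussianReal_eq_integral_smul hV0]
  have hlin : ∫ s in (b - r)..(b + r), κ * (1 + z * (s - b)) = κ * (2 * r) := by
    rw [intervalIntegral.integral_comp_sub_right (fun s => κ * (1 + z * s)) b,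
      intervalIntegral.integral_const_mul, intervalIntegral.integral_add
        (by simp) (Continuous.intervalIntegrable (by fun_prop) _ _),
      intervalIntegral.integral_const_mul, integral_id]
    simp
    left; ring
  rw [← hlin, intervalIntegral.integral_of_le (by linarith)]
  calc ∫ s in Set.Ioc (b - r) (b + r), κ * (1 + z * (s - b))
      ≤ ∫ s in Set.Ioc (b - r) (b + r),
          gaussianPDFReal 0 V s * Real.exp (z * (s - b) - c * (s - b) ^ 2) := by
        refine setIntegral_mono_on ?_ hI'.integrableOn measurableSet_Ioc fun s hs => ?_
        · exact (Continuous.integrableOn_Ioc (by fun_prop))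
        · have h1 : |s - b| ≤ r := abs_le.2 ⟨by linarith [hs.1], by linarith [hs.2]⟩
          have h2 : (s - b) ^ 2 ≤ r ^ 2 := sq_le_sq' (abs_le.1 h1).1 (abs_le.1 h1).2
          have h3 : (s - 0) ^ 2 ≤ (C + 1) ^ 2 := by
            have : |s| ≤ C + 1 := by
              calc |s| = |(s - b) + b| := by ring_nf
                _ ≤ |s - b| + |b| := abs_add_le _ _
                _ ≤ C + 1 := by linarith
            rw [sub_zero]
            exact sq_le_sq' (abs_le.1 this).1 (abs_le.1 this).2
          have hpdf : (√(2 * Real.pi * v₁))⁻¹ * Real.exp (-(C + 1) ^ 2 / (2 * v₀)) ≤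
              gaussianPDFReal 0 V s := by
            rw [gaussianPDFReal]
            refine mul_le_mul (inv_anti₀ (by positivity) (Real.sqrt_le_sqrt (by gcongr)))
              (Real.exp_le_exp.2 ?_) (Real.exp_pos _).le (by positivity)
            rw [neg_div, neg_div, neg_le_neg_iff]
            exact div_le_div₀ (sq_nonneg _) h3 (by positivity) (by linarith)
          have hexp : Real.exp (-c * r ^ 2) * (1 + z * (s - b)) ≤
              Real.exp (z * (s - b) - c * (s - b) ^ 2) := by
            rw [show z * (s - b) - c * (s - b) ^ 2 = -c * (s - b) ^ 2 + z * (s - b) by ring,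
              Real.exp_add]
            calc _ ≤ Real.exp (-c * r ^ 2) * Real.exp (z * (s - b)) :=
                  mul_le_mul_of_nonneg_left (by linarith [Real.add_one_le_exp (z * (s - b))])
                    (Real.exp_pos _).le
              _ ≤ _ := by
                  refine mul_le_mul_of_nonneg_right (Real.exp_le_exp.2 ?_) (Real.exp_pos _).le
                  nlinarith
          calc κ * (1 + z * (s - b))
              = (√(2 * Real.pi * v₁))⁻¹ * Real.exp (-(C + 1) ^ 2 / (2 * v₀)) *
                (Real.exp (-c * r ^ 2) * (1 + z * (s - b))) := by ring
            _ ≤ (√(2 * Real.pi * v₁))⁻¹ * Real.exp (-(C + 1) ^ 2 / (2 * v₀)) *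
                Real.exp (z * (s - b) - c * (s - b) ^ 2) :=
                mul_le_mul_of_nonneg_left hexp (by positivity)
            _ ≤ _ := mul_le_mul_of_nonneg_right hpdf (Real.exp_pos _).le
    _ ≤ ∫ s, gaussianPDFReal 0 V s * Real.exp (z * (s - b) - c * (s - b) ^ 2) :=
        setIntegral_le_integral hI' (ae_of_all _ fun s =>
          mul_nonneg (gaussianPDFReal_nonneg _ _ _) (Real.exp_pos _).le)

/-! ### Bounds on the relative likelihood -/

lemma prod_segments_ite {l p : ℕ} (m : Finset (Fin p)) (a : ℝ) :
    ∏ _j : Fin (l + 1), ∏ k, (if k ∈ m then a else 1) = a ^ ((l + 1) * m.card) := by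
  rw [Finset.prod_const, Finset.prod_ite_mem, Finset.univ_inter, Finset.prod_const, ← pow_mul,
    Finset.card_univ, Fintype.card_fin, mul_comm]

lemma blockEnergy_nonneg {n p l l' : ℕ} (x : Fin n → Fin p → ℝ) (t : Fin l → ℝ)
    (t' : Fin l' → ℝ) (β : Fin (l + 1) → Fin p → ℝ) (β' : Fin (l' + 1) → Fin p → ℝ)
    (j : Fin (l + 1)) (j' : Fin (l' + 1)) : 0 ≤ blockEnergy x t t' β β' j j' :=
  Finset.sum_nonneg fun _ _ => sq_nonneg _

/-- The true model puts mass of order `n ^ (-1/2)` per coefficient on the `n ^ (-1/2)`-neighbourhood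
of the truth, so its marginal likelihood loses no more than this factor.  The bound holds for
every response `y`. -/
lemma le_relativeLikelihood_self {n p l' : ℕ} (hn : 0 < n) (x : Fin n → Fin p → ℝ) {σ2 V : ℝ≥0}
    (hσ2 : 0 < σ2) {v₀ v₁ : ℝ} (hv₀ : 0 < v₀) (hV : v₀ ≤ V) (hV1 : V ≤ v₁) {t' : Fin l' → ℝ}
    {m' : Finset (Fin p)} {β' : Fin (l' + 1) → Fin p → ℝ} {C B : ℝ}
    (hβ' : ∀ j, ∀ k ∉ m', β' j k = 0) (hC : ∀ j k, |β' j k| ≤ C) (hB0 : 0 < B)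
    (hB : ∀ (j : Fin (l' + 1)) (h : Fin p → ℝ), (∀ k ∉ m', h k = 0) →
      ∑ i ∈ jointSegment n t' t' j j, (∑ k, x i k * h k) ^ 2 ≤ B * n * ∑ k, h k ^ 2)
    (y : Fin n → ℝ) :
    ((√(2 * Real.pi * v₁))⁻¹ * Real.exp (-(C + 1) ^ 2 / (2 * v₀)) *
        Real.exp (-(B / (2 * σ2))) * 2 / √n) ^ ((l' + 1) * m'.card) ≤
      relativeLikelihood x σ2 V t' m' t' β' y := by
  classical
  have hσ : (0 : ℝ) < σ2 := by exact_mod_cast hσ2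
  have hn0 : (0 : ℝ) < n := by exact_mod_cast hn
  have hn1 : (1 : ℝ) ≤ n := by exact_mod_cast hn
  set e : Fin n → ℝ := fun i => y i - regressionMean x t' β' i with he
  set c : ℝ := B * n / (2 * σ2) with hc
  have hc0 : 0 < c := by positivity
  set f : Fin (l' + 1) → Fin p → ℝ → ℝ := fun j k s =>
    Real.exp (blockScore x t' t' e j j k / σ2 * (s - β' j k) - c * (s - β' j k) ^ 2) with hf
  -- the integrand with `B * n * ‖h‖ ^ 2` for the quadratic part, which factors over coefficients
  have hslab : ∀ j k, _ := fun j k => le_integral_exp_slab hv₀ hV hV1 hc0 (hC j k)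
    (r := (√n)⁻¹) (by positivity) (inv_le_one_of_one_le₀ (Real.one_le_sqrt.2 hn1))
    (blockScore x t' t' e j j k / σ2)
  have hfint : ∀ j k, Integrable (f j k)
      (if k ∈ m' then gaussianReal 0 V else Measure.dirac 0) := fun j k => by
    split_ifs with hk
    · exact (hslab j k).1
    · exact integrable_dirac (by simp)
  have hcr : c * (√(n : ℝ))⁻¹ ^ 2 = B / (2 * σ2) := by
    rw [inv_pow, Real.sq_sqrt hn0.le, hc]
    field_simp
  rw [← prod_segments_ite]
  calc _ ≤ ∏ j, ∏ k, ∫ s, f j k s ∂(if k ∈ m' then gaussianReal 0 V else Measure.dirac 0) := by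
        refine Finset.prod_le_prod (fun j _ => Finset.prod_nonneg fun k _ => ?_) fun j _ =>
          Finset.prod_le_prod (fun k _ => ?_) fun k _ => ?_
        · split_ifs <;> positivity
        · split_ifs <;> positivity
        · split_ifs with hk
          · have := (hslab j k).2
            rw [neg_mul, hcr] at this
            refine le_trans (le_of_eq ?_) this
            ring
          · simp [hf, hβ' j k hk]
    _ = ∫ β, ∏ j, ∏ k, f j k (β j k) ∂coefficientPrior l' p V m' :=
        (integral_prod_coefficientPrior V m' f).symm
    _ ≤ relativeLikelihood x σ2 V t' m' t' β' y := by
        refine integral_mono_ae (integrable_prod_coefficientPrior V m' hfint)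
          (integrable_exp_gaussianGain x σ2 V t' m' e _) ?_
        filter_upwards [coefficientPrior_ae_eq_zero l' p V m'] with β hβ
        simp only [hf, ← Real.exp_sum]
        rw [Real.exp_le_exp, gaussianGain_eq_sum_blocks, Finset.sum_div]
        refine Finset.sum_le_sum fun j _ => ?_
        -- the joint segments of `t'` with itself off the diagonal are empty
        have hdiag : ∀ j' ≠ j, jointSegment n t' t' j j' = ∅ := fun j' hj' => by
          refine Finset.filter_eq_empty_iff.2 fun i _ hi => hj' (hi.2.symm.trans hi.1)
        rw [Finset.sum_eq_single j (fun j' _ hj' => by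
          simp [blockScore, blockEnergy, hdiag j' hj']) (by simp), sub_div, Finset.sum_div,
          Finset.sum_sub_distrib]
        have h1 := hB j (fun k => β j k - β' j k) fun k hk => by simp [hβ j k hk, hβ' j k hk]
        refine sub_le_sub (le_of_eq (Finset.sum_congr rfl fun k _ => by ring)) ?_
        rw [← Finset.mul_sum, hc, div_div, div_le_iff₀ (by positivity), blockEnergy]
        refine h1.trans (le_of_eq ?_)
        field_simp

/-- On each joint segment the linear term is bounded by Young's inequality, which spends half of the
quadratic term; the remaining half is kept as the distance of the mean vectors. -/
lemma gaussianGain_le_scoreSq {n p l l' : ℕ} (hn : 0 < n) (x : Fin n → Fin p → ℝ)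
    {t : Fin l → ℝ} (ht : IsChangePoints t) {t' : Fin l' → ℝ} (ht' : IsChangePoints t')
    {w : Finset (Fin p)} {a : ℝ} (ha : 0 < a)
    (hA : ∀ (j : Fin (l + 1)) (j' : Fin (l' + 1)) (h : Fin p → ℝ), (∀ k ∉ w, h k = 0) →
      SegmentsOverlap t t' j j' →
      a * n * ∑ k, h k ^ 2 ≤ ∑ i ∈ jointSegment n t t' j j', (∑ k, x i k * h k) ^ 2)
    {β : Fin (l + 1) → Fin p → ℝ} (hβ : ∀ j, ∀ k ∉ w, β j k = 0)
    {β' : Fin (l' + 1) → Fin p → ℝ} (hβ' : ∀ j, ∀ k ∉ w, β' j k = 0) (e : Fin n → ℝ) :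
    gaussianGain e (fun i => regressionMean x t β i - regressionMean x t' β' i) ≤
      scoreSq x t t' w e / (a * n) - (∑ j, ∑ j', blockEnergy x t t' β β' j j') / 4 := by
  have hn0 : (0 : ℝ) < n := by exact_mod_cast hn
  have han : 0 < a * n := by positivity
  rw [gaussianGain_eq_sum_blocks, scoreSq, Finset.sum_div, Finset.sum_div,
    ← Finset.sum_sub_distrib]
  refine Finset.sum_le_sum fun j _ => ?_
  rw [Finset.sum_div, Finset.sum_div, ← Finset.sum_sub_distrib]
  refine Finset.sum_le_sum fun j' _ => ?_
  by_cases hov : SegmentsOverlap t t' j j'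
  · have h0 : ∀ k ∉ w, β j k - β' j' k = 0 := fun k hk => by simp [hβ j k hk, hβ' j' k hk]
    have h1 := hA j j' (fun k => β j k - β' j' k) h0 hov
    change _ ≤ blockEnergy x t t' β β' j j' at h1
    have h2 : ∑ k, blockScore x t t' e j j' k * (β j k - β' j' k) ≤
        (∑ k ∈ w, blockScore x t t' e j j' k ^ 2) / (a * n) +
          a * n * (∑ k, (β j k - β' j' k) ^ 2) / 4 := by
      rw [← Finset.sum_subset (Finset.subset_univ w) fun k _ hk => by simp [h0 k hk],
        ← Finset.sum_subset (Finset.subset_univ w) (f := fun k => (β j k - β' j' k) ^ 2)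
          fun k _ hk => by simp [h0 k hk],
        Finset.mul_sum, Finset.sum_div, Finset.sum_div, ← Finset.sum_add_distrib]
      refine Finset.sum_le_sum fun k _ => ?_
      set z := blockScore x t t' e j j' k
      set d := β j k - β' j' k
      have : z ^ 2 / (a * n) + a * n * d ^ 2 / 4 - z * d = (z - a * n * d / 2) ^ 2 / (a * n) := by
        field_simp; ring
      have h3 : 0 ≤ (z - a * n * d / 2) ^ 2 / (a * n) := by positivity
      linarith
    linarith
  · simp [blockScore, blockEnergy, jointSegment_eq_empty n ht ht' hov]

/-- A model whose mean vectors all stay away from the true one, at a squared distance `D`, loses a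
factor exponential in `D`. -/
lemma relativeLikelihood_le_of_separated {n p l l' : ℕ} (hn : 0 < n) (x : Fin n → Fin p → ℝ)
    (σ2 V : ℝ≥0) {t : Fin l → ℝ} (ht : IsChangePoints t) {t' : Fin l' → ℝ}
    (ht' : IsChangePoints t') {m w : Finset (Fin p)} (hmw : m ⊆ w) {a : ℝ} (ha : 0 < a)
    (hA : ∀ (j : Fin (l + 1)) (j' : Fin (l' + 1)) (h : Fin p → ℝ), (∀ k ∉ w, h k = 0) →
      SegmentsOverlap t t' j j' →
      a * n * ∑ k, h k ^ 2 ≤ ∑ i ∈ jointSegment n t t' j j', (∑ k, x i k * h k) ^ 2)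
    {β' : Fin (l' + 1) → Fin p → ℝ} (hβ' : ∀ j, ∀ k ∉ w, β' j k = 0) {D : ℝ}
    (hD : ∀ β : Fin (l + 1) → Fin p → ℝ, (∀ j, ∀ k ∉ m, β j k = 0) →
      D ≤ ∑ j, ∑ j', blockEnergy x t t' β β' j j') (y : Fin n → ℝ) :
    relativeLikelihood x σ2 V t m t' β' y ≤
      Real.exp ((scoreSq x t t' w (fun i => y i - regressionMean x t' β' i) / (a * n) - D / 4) /
        σ2) := by
  have hconst : ∀ r : ℝ, ∫ _, r ∂coefficientPrior l p V m = r := fun r => by simp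
  rw [relativeLikelihood, ← hconst (Real.exp _)]
  refine integral_mono_ae (integrable_exp_gaussianGain x σ2 V t m _ _) (integrable_const _) ?_
  filter_upwards [coefficientPrior_ae_eq_zero l p V m] with β hβ
  rw [Real.exp_le_exp]
  refine div_le_div_of_nonneg_right ?_ σ2.coe_nonneg
  have h1 := gaussianGain_le_scoreSq hn x ht ht' ha hA
    (fun j k hk => hβ j k fun h => hk (hmw h)) hβ' fun i => y i - regressionMean x t' β' i
  linarith [hD β hβ]

/-- Each coefficient of a model costs a factor of order `n ^ (-1/2)`: only a neighbourhood of this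
size of a coefficient vector carries the likelihood. -/
lemma relativeLikelihood_le_of_slab {n p l l' : ℕ} (hn : 0 < n) (x : Fin n → Fin p → ℝ)
    {σ2 V : ℝ≥0} (hσ2 : 0 < σ2) {v₀ : ℝ} (hv₀ : 0 < v₀) (hV : v₀ ≤ V) {t : Fin l → ℝ}
    (ht : IsChangePoints t) {t' : Fin l' → ℝ} (ht' : IsChangePoints t')
    {m w : Finset (Fin p)} (hmw : m ⊆ w) {a : ℝ} (ha : 0 < a)
    (hA : ∀ (j : Fin (l + 1)) (j' : Fin (l' + 1)) (h : Fin p → ℝ), (∀ k ∉ w, h k = 0) →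
      SegmentsOverlap t t' j j' →
      a * n * ∑ k, h k ^ 2 ≤ ∑ i ∈ jointSegment n t t' j j', (∑ k, x i k * h k) ^ 2)
    {β' : Fin (l' + 1) → Fin p → ℝ} (hβ' : ∀ j, ∀ k ∉ w, β' j k = 0) (y : Fin n → ℝ) :
    relativeLikelihood x σ2 V t m t' β' y ≤
      Real.exp (scoreSq x t t' w (fun i => y i - regressionMean x t' β' i) / (a * n) / σ2) *
        ((√(2 * Real.pi * v₀))⁻¹ * √(4 * Real.pi * σ2 / a) / √n) ^ ((l + 1) * m.card) := by
  classical
  have hσ : (0 : ℝ) < σ2 := by exact_mod_cast hσ2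
  have hn0 : (0 : ℝ) < n := by exact_mod_cast hn
  -- the coefficients of segment `j` are compared with those of one true segment that it overlaps
  choose φ hφ using exists_segmentsOverlap_right ht ht'
  set e : Fin n → ℝ := fun i => y i - regressionMean x t' β' i with he
  set c : ℝ := a * n / (4 * σ2) with hc
  have hc0 : 0 < c := by positivity
  set f : Fin (l + 1) → Fin p → ℝ → ℝ := fun j k s =>
    if k ∈ m then Real.exp (-c * (s - β' (φ j) k) ^ 2) else 1 with hf
  have hslab : ∀ j k, _ := fun j k => integral_exp_slab_le hv₀ hV hc0 (β' (φ j) k)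
  have hfint : ∀ j k, Integrable (f j k)
      (if k ∈ m then gaussianReal 0 V else Measure.dirac 0) := fun j k => by
    by_cases hk : k ∈ m
    · simpa [hf, hk] using (hslab j k).1
    · simp only [hf, hk, if_false]
      exact integrable_const _
  have hsqrt : √(Real.pi / c) = √(4 * Real.pi * σ2 / a) / √n := by
    rw [← Real.sqrt_div (by positivity), hc]
    congr 1
    field_simp
  calc relativeLikelihood x σ2 V t m t' β' y
      ≤ ∫ β, Real.exp (scoreSq x t t' w e / (a * n) / σ2) * ∏ j, ∏ k, f j k (β j k)
          ∂coefficientPrior l p V m := by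
        refine integral_mono_ae (integrable_exp_gaussianGain x σ2 V t m _ _)
          ((integrable_prod_coefficientPrior V m hfint).const_mul _) ?_
        filter_upwards [coefficientPrior_ae_eq_zero l p V m] with β hβ
        have hβw : ∀ j, ∀ k ∉ w, β j k = 0 := fun j k hk => hβ j k fun h => hk (hmw h)
        have h1 := gaussianGain_le_scoreSq hn x ht ht' ha hA hβw hβ' e
        have h2 : ∏ j, ∏ k, f j k (β j k) =
            Real.exp (-c * ∑ j, ∑ k ∈ m, (β j k - β' (φ j) k) ^ 2) := by
          simp only [hf, Finset.prod_ite_mem, Finset.univ_inter, ← Real.exp_sum, Finset.mul_sum]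
        have h3 : a * n * ∑ j, ∑ k ∈ m, (β j k - β' (φ j) k) ^ 2 ≤
            ∑ j, ∑ j', blockEnergy x t t' β β' j j' := by
          rw [Finset.mul_sum]
          refine Finset.sum_le_sum fun j _ => ?_
          have h4 := hA j (φ j) (fun k => β j k - β' (φ j) k)
            (fun k hk => by simp [hβw j k hk, hβ' (φ j) k hk]) (hφ j)
          change _ ≤ blockEnergy x t t' β β' j (φ j) at h4
          refine le_trans ?_ (h4.trans (Finset.single_le_sum
            (f := fun j' => blockEnergy x t t' β β' j j')
            (fun j' _ => blockEnergy_nonneg x t t' β β' j j') (Finset.mem_univ (φ j))))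
          exact mul_le_mul_of_nonneg_left (Finset.sum_le_sum_of_subset_of_nonneg
            (Finset.subset_univ m) fun _ _ _ => sq_nonneg _) (by positivity)
        rw [h2, ← Real.exp_add, Real.exp_le_exp, div_le_iff₀ hσ, add_mul,
          div_mul_cancel₀ _ hσ.ne']
        refine h1.trans ?_
        have h5 : -c * (∑ j, ∑ k ∈ m, (β j k - β' (φ j) k) ^ 2) * σ2 =
            -(a * n * ∑ j, ∑ k ∈ m, (β j k - β' (φ j) k) ^ 2) / 4 := by
          rw [hc]; field_simp
        rw [h5]
        linarith
    _ ≤ _ := by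
        rw [integral_const_mul, integral_prod_coefficientPrior, ← prod_segments_ite]
        refine mul_le_mul_of_nonneg_left (Finset.prod_le_prod (fun j _ => Finset.prod_nonneg
          fun k _ => ?_) fun j _ => Finset.prod_le_prod (fun k _ => ?_) fun k _ => ?_)
          (Real.exp_pos _).le
        · exact integral_nonneg fun s => by simp only [hf]; split_ifs <;> positivity
        · exact integral_nonneg fun s => by simp only [hf]; split_ifs <;> positivity
        · by_cases hk : k ∈ m
          · have := (hslab j k).2
            rw [hsqrt, ← mul_div_assoc] at this
            simpa [hf, hk] using this
          · simp [hf, hk]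

/-! ### Separation of misspecified models from the truth -/

/-- A model without a covariate that is active in the truth is separated from the truth. -/
lemma energy_ge_of_missing_covariate {n p l l' : ℕ} (x : Fin n → Fin p → ℝ)
    {t : Fin l → ℝ} (ht : IsChangePoints t) {t' : Fin l' → ℝ} (ht' : IsChangePoints t')
    {w : Finset (Fin p)} {a : ℝ} (ha : 0 < a)
    (hA : ∀ (j : Fin (l + 1)) (j' : Fin (l' + 1)) (h : Fin p → ℝ), (∀ k ∉ w, h k = 0) →
      SegmentsOverlap t t' j j' →
      a * n * ∑ k, h k ^ 2 ≤ ∑ i ∈ jointSegment n t t' j j', (∑ k, x i k * h k) ^ 2)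
    {β : Fin (l + 1) → Fin p → ℝ} (hβ : ∀ j, ∀ k ∉ w, β j k = 0)
    {β' : Fin (l' + 1) → Fin p → ℝ} (hβ' : ∀ j, ∀ k ∉ w, β' j k = 0)
    {k : Fin p} (hk : ∀ j, β j k = 0) {j' : Fin (l' + 1)} {c : ℝ} (hc : 0 ≤ c)
    (hck : c ≤ |β' j' k|) :
    a * n * c ^ 2 ≤ ∑ j, ∑ j', blockEnergy x t t' β β' j j' := by
  obtain ⟨j, hj⟩ := exists_segmentsOverlap_left ht ht' j'
  have h1 := hA j j' (fun k => β j k - β' j' k)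
    (fun k hk => by simp [hβ j k hk, hβ' j' k hk]) hj
  change _ ≤ blockEnergy x t t' β β' j j' at h1
  have h2 : c ^ 2 ≤ ∑ k, (β j k - β' j' k) ^ 2 := by
    refine le_trans ?_ (Finset.single_le_sum (f := fun k => (β j k - β' j' k) ^ 2)
      (fun _ _ => sq_nonneg _) (Finset.mem_univ k))
    simp only [hk j, zero_sub, neg_sq]
    rw [← sq_abs (β' j' k)]
    exact pow_le_pow_left₀ hc hck 2
  calc a * n * c ^ 2 ≤ a * n * ∑ k, (β j k - β' j' k) ^ 2 :=
        mul_le_mul_of_nonneg_left h2 (by positivity)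
    _ ≤ blockEnergy x t t' β β' j j' := h1
    _ ≤ ∑ j', blockEnergy x t t' β β' j j' :=
        Finset.single_le_sum (f := fun j' => blockEnergy x t t' β β' j j')
          (fun j' _ => blockEnergy_nonneg ..) (Finset.mem_univ j')
    _ ≤ _ := Finset.single_le_sum (f := fun j => ∑ j', blockEnergy x t t' β β' j j')
          (fun j _ => Finset.sum_nonneg fun j' _ => blockEnergy_nonneg ..) (Finset.mem_univ j)

/-- A model without a change point of the truth is separated from the truth: one coefficient vector
has to serve both sides of the jump. -/
lemma energy_ge_of_missing_changePoint {n p l l' : ℕ} (x : Fin n → Fin p → ℝ)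
    {t : Fin l → ℝ} (ht : IsChangePoints t) {t' : Fin l' → ℝ} (ht' : IsChangePoints t')
    {w : Finset (Fin p)} {a : ℝ} (ha : 0 < a)
    (hA : ∀ (j : Fin (l + 1)) (j' : Fin (l' + 1)) (h : Fin p → ℝ), (∀ k ∉ w, h k = 0) →
      SegmentsOverlap t t' j j' →
      a * n * ∑ k, h k ^ 2 ≤ ∑ i ∈ jointSegment n t t' j j', (∑ k, x i k * h k) ^ 2)
    {β : Fin (l + 1) → Fin p → ℝ} (hβ : ∀ j, ∀ k ∉ w, β j k = 0)
    {β' : Fin (l' + 1) → Fin p → ℝ} (hβ' : ∀ j, ∀ k ∉ w, β' j k = 0)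
    {r : Fin l'} (hr : t' r ∉ Set.range t) {δ : ℝ}
    (hδ : δ ≤ ∑ k, (β' r.succ k - β' r.castSucc k) ^ 2) :
    a * n * (δ / 2) ≤ ∑ j, ∑ j', blockEnergy x t t' β β' j j' := by
  obtain ⟨j, hj1, hj2⟩ := exists_segmentsOverlap_both ht ht' r hr
  have h1 : ∀ j', SegmentsOverlap t t' j j' →
      a * n * ∑ k, (β j k - β' j' k) ^ 2 ≤ blockEnergy x t t' β β' j j' := fun j' hj' =>
    hA j j' (fun k => β j k - β' j' k) (fun k hk => by simp [hβ j k hk, hβ' j' k hk]) hj'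
  have h2 : δ / 2 ≤ ∑ k, (β j k - β' r.castSucc k) ^ 2 + ∑ k, (β j k - β' r.succ k) ^ 2 := by
    refine (div_le_div_of_nonneg_right hδ zero_le_two).trans ?_
    rw [Finset.sum_div, ← Finset.sum_add_distrib]
    exact Finset.sum_le_sum fun k _ => by
      nlinarith [sq_nonneg ((β j k - β' r.castSucc k) + (β j k - β' r.succ k))]
  calc a * n * (δ / 2) ≤ a * n *
        (∑ k, (β j k - β' r.castSucc k) ^ 2 + ∑ k, (β j k - β' r.succ k) ^ 2) :=
        mul_le_mul_of_nonneg_left h2 (by positivity)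
    _ ≤ blockEnergy x t t' β β' j r.castSucc + blockEnergy x t t' β β' j r.succ := by
        rw [mul_add]; exact add_le_add (h1 _ hj1) (h1 _ hj2)
    _ = ∑ j' ∈ {r.castSucc, r.succ}, blockEnergy x t t' β β' j j' :=
        (Finset.sum_pair (Fin.castSucc_lt_succ (i := r)).ne).symm
    _ ≤ ∑ j', blockEnergy x t t' β β' j j' :=
        Finset.sum_le_sum_of_subset_of_nonneg (Finset.subset_univ _)
          fun j' _ _ => blockEnergy_nonneg ..
    _ ≤ _ := Finset.single_le_sum (f := fun j => ∑ j', blockEnergy x t t' β β' j j')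
          (fun j _ => Finset.sum_nonneg fun j' _ => blockEnergy_nonneg ..) (Finset.mem_univ j)

/-! ### Growth rates -/

/-- `q n * log n` is of smaller order than `n`, and in fact at most `√n` eventually. -/
lemma ModelSizeCondition.eventually_mul_log_le {q : ℕ → ℕ} {ε : ℕ → ℝ}
    (h : ModelSizeCondition q ε) (A : ℝ) {c : ℝ} (hc : 0 < c) :
    ∀ᶠ n : ℕ in atTop, A * (q n * Real.log n) ≤ c * n := by
  obtain ⟨hε, hε0, -, hlo, -⟩ := h
  have h1 := hlo.bound zero_lt_one
  have h2 : ∀ᶠ n in atTop, ε n ≤ 1 := hε0.eventually_le_const zero_lt_one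
  have h3 : Tendsto (fun n : ℕ => √(n : ℝ)) atTop atTop :=
    Real.tendsto_sqrt_atTop.comp tendsto_natCast_atTop_atTop
  filter_upwards [h1, h2, h3.eventually_ge_atTop (|A| / c)] with n hn1 hn2 hn3
  have hn0 : (0 : ℝ) ≤ n := Nat.cast_nonneg n
  have hlog : 0 ≤ (q n : ℝ) * Real.log n :=
    mul_nonneg (Nat.cast_nonneg _) (Real.log_natCast_nonneg n)
  have h4 : ((q n : ℝ) * Real.log n) ^ 2 ≤ n := by
    rw [Real.norm_of_nonneg (sq_nonneg _), Real.norm_of_nonneg (mul_nonneg hn0 (hε n).le),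
      one_mul] at hn1
    exact hn1.trans (mul_le_of_le_one_right hn0 hn2)
  have h5 : (q n : ℝ) * Real.log n ≤ √n := Real.le_sqrt_of_sq_le h4
  rw [div_le_iff₀ hc] at hn3
  calc A * (q n * Real.log n) ≤ |A| * (q n * Real.log n) :=
        mul_le_mul_of_nonneg_right (le_abs_self A) hlog
    _ ≤ |A| * √n := mul_le_mul_of_nonneg_left h5 (abs_nonneg A)
    _ ≤ √n * c * √n := mul_le_mul_of_nonneg_right hn3 (Real.sqrt_nonneg _)
    _ = c * n := by rw [mul_right_comm, Real.mul_self_sqrt hn0, mul_comm]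

/-- The exponent of `n` is `1/8 - (l + 1) / 2 + l / 2 = -3/8`. -/
lemma tendsto_overfit_rate (K κ : ℝ) (l : ℕ) :
    Tendsto (fun n : ℕ => Real.exp (Real.log n / 8) * (K / √n) ^ (l + 1) / (κ / √n) ^ l) atTop
      (𝓝 0) := by
  have h1 : Tendsto (fun n : ℕ => K ^ (l + 1) / κ ^ l * (n : ℝ) ^ (-(3 / 8) : ℝ)) atTop (𝓝 0) := by
    have := ((tendsto_rpow_neg_atTop (y := 3 / 8) (by norm_num)).comp
      tendsto_natCast_atTop_atTop).const_mul (K ^ (l + 1) / κ ^ l)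
    simpa using this
  refine h1.congr' ?_
  filter_upwards [eventually_gt_atTop 0] with n hn
  have hn0 : (0 : ℝ) < n := by exact_mod_cast hn
  have hs : 0 < √(n : ℝ) := Real.sqrt_pos.2 hn0
  have h2 : (n : ℝ) ^ (-(3 / 8) : ℝ) = Real.exp (Real.log n / 8) / √n := by
    rw [Real.sqrt_eq_rpow, Real.rpow_def_of_pos hn0, Real.rpow_def_of_pos hn0, ← Real.exp_sub]
    congr 1; ring
  have h3 : √(n : ℝ) ^ l ≠ 0 := (pow_pos hs l).ne'
  rw [h2, div_pow, div_pow, pow_succ (√(n : ℝ))]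
  by_cases hκ : κ ^ l = 0
  · simp [hκ]
  · field_simp

/-- In an overfitted model the `(l + 1) * w` coefficients exceed those of the truth by at least
`w`, and the factor `n ^ (-1/2)` of each of these outweighs the score. -/
lemma overfit_ratio_le {l lstar w ws : ℕ} (hl : lstar + 1 ≤ l) (hws : ws ≤ w) {K κ E u : ℝ}
    (hK : 0 ≤ K) (hκ : 0 < κ) (hκ1 : κ ≤ 1) (hE : 0 ≤ E) {R Rs : ℝ} (hu : u ≤ E ^ w)
    (hR : R ≤ u * K ^ ((l + 1) * w)) (hRs : κ ^ ((lstar + 1) * ws) ≤ Rs) :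
    R / Rs ≤ (E * K ^ (l + 1) / κ ^ l) ^ w := by
  have h1 : (κ ^ l) ^ w ≤ Rs := by
    rw [← pow_mul]
    exact (pow_le_pow_of_le_one hκ.le hκ1 (Nat.mul_le_mul hl hws)).trans hRs
  have h2 : 0 < (κ ^ l) ^ w := by positivity
  rw [div_pow, mul_pow, ← pow_mul K]
  exact div_le_div₀ (by positivity)
    (hR.trans (mul_le_mul_of_nonneg_right hu (by positivity))) h2 h1

/-- The exponential loss of a separated model outweighs the score and the prior mass of the
truth. -/
lemma underfit_ratio_le {lstar w ws q n : ℕ} (hn : 0 < n) (hlog : 1 ≤ Real.log n) (hw : w ≤ 2 * q)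
    (hws : ws ≤ q) {κ c : ℝ} (hκ : 0 < κ) (hκ1 : κ ≤ 1)
    (hq : (1 / 4 + (lstar + 1) * (1 / 2 - Real.log κ)) * (q * Real.log n) ≤ c / 2 * n)
    {R Rs : ℝ} (hR : R ≤ Real.exp (w * (Real.log n / 8) - c * n))
    (hRs : (κ / √n) ^ ((lstar + 1) * ws) ≤ Rs) :
    R / Rs ≤ Real.exp (-(c / 2 * n)) := by
  have hn0 : (0 : ℝ) < n := by exact_mod_cast hn
  have hκn : 0 < κ / √n := by positivity
  have hlogκ : Real.log κ ≤ 0 := Real.log_nonpos hκ.le hκ1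
  have hwr : (w : ℝ) ≤ 2 * q := by exact_mod_cast hw
  have hwsr : (ws : ℝ) ≤ q := by exact_mod_cast hws
  have hpow : (κ / √n) ^ ((lstar + 1) * ws) =
      Real.exp ((lstar + 1) * ws * (Real.log κ - Real.log n / 2)) := by
    rw [← Real.log_sqrt hn0.le, ← Real.log_div hκ.ne' (by positivity),
      ← Real.rpow_natCast, Real.rpow_def_of_pos hκn]
    push_cast
    ring_nf
  have hRs0 : 0 < Rs := (pow_pos hκn _).trans_le hRs
  rw [div_le_iff₀ hRs0]
  refine hR.trans ?_
  refine le_trans ?_ (mul_le_mul_of_nonneg_left hRs (Real.exp_pos _).le)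
  rw [hpow, ← Real.exp_add, Real.exp_le_exp]
  have h1 : (w : ℝ) * (Real.log n / 8) ≤ 2 * q * (Real.log n / 8) :=
    mul_le_mul_of_nonneg_right hwr (by linarith)
  have h2 : ((lstar : ℝ) + 1) * ws * (Real.log n / 2 - Real.log κ) ≤
      (lstar + 1) * q * (Real.log n / 2 - Real.log κ) :=
    mul_le_mul_of_nonneg_right (mul_le_mul_of_nonneg_left hwsr (by positivity)) (by linarith)
  have h3 : ((lstar : ℝ) + 1) * q * (-Real.log κ) * 1 ≤
      (lstar + 1) * q * (-Real.log κ) * Real.log n :=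
    mul_le_mul_of_nonneg_left hlog
      (mul_nonneg (by positivity) (by linarith))
  nlinarith [h1, h2, h3, hq]

/-! ### Convergence of the Bayes factor -/

theorem mainTheorem1
    -- the design: at sample size `n`, the row `x n i` holds the `p n` covariates of observation `i`
    (p : ℕ → ℕ) (x : (n : ℕ) → Fin n → Fin (p n) → ℝ)
    -- the known error variance, the slab variance and the maximal model size
    (σ2 : ℝ≥0) (hσ2 : 0 < σ2) (V : ℕ → ℝ≥0) (q : ℕ → ℕ) (ε : ℕ → ℝ)
    -- the truth
    (lstar : ℕ) (tstar : Fin lstar → ℝ) (βstar : (n : ℕ) → Fin (lstar + 1) → Fin (p n) → ℝ)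
    (hmstar : ∀ n, (activeCovariates (βstar n)).card ≤ q n)
    -- the alternative model
    (l : ℕ) (hl : l ≠ lstar) (t : Fin l → ℝ) (ht : IsChangePoints t)
    (m : (n : ℕ) → Finset (Fin (p n))) (hm : ∀ n, (m n).card ≤ q n)
    (hne : ∀ n, (m n ∪ activeCovariates (βstar n)).Nonempty)
    -- the assumptions on design, coefficients, model size, slab variance and change points
    (hA1 : CovariatesBounded x)
    (hA2 : CoefficientsBounded βstar)
    (hA3 : ModelSizeCondition q ε)
    (hA4 : SlabVarianceCondition V)
    (hA5 : IsChangePoints tstar)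
    (hA6 : SingularValueCondition x fun n => m n ∪ activeCovariates (βstar n)) :
    ∀ η : ℝ, 0 < η →
      Tendsto (fun n => responseLaw (x n) σ2 tstar (βstar n)
        {y | η ≤ |bayesFactor (x n) σ2 (V n) t (m n) tstar (activeCovariates (βstar n)) y|})
        atTop (𝓝 0) := by
  classical
  intro η hη
  obtain ⟨K₀, hK₀⟩ := hA1
  obtain ⟨⟨c, C, hc, hcC⟩, δ, hδ, hjump⟩ := hA2
  obtain ⟨v₀, v₁, hv₀, hV⟩ := hA4
  obtain ⟨a, _, ha, -, hab⟩ := hA6.joint_quadratic_bounds ht hA5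
  obtain ⟨_, B, -, hB0, hB⟩ := hA6.joint_quadratic_bounds hA5 hA5
  have hσ : (0 : ℝ) < σ2 := by exact_mod_cast hσ2
  have hv₀' : (0 : ℝ) < v₀ := by exact_mod_cast hv₀
  have hv₁' : (0 : ℝ) < v₁ := by exact_mod_cast hv₀.trans_le ((hV 0).1.trans (hV 0).2)
  set C' : ℝ := max C 0 with hC'
  set κ₀ : ℝ := (√(2 * Real.pi * v₁))⁻¹ * Real.exp (-(C' + 1) ^ 2 / (2 * v₀)) *
    Real.exp (-(B / (2 * σ2))) * 2
  have hκ₀0 : 0 < κ₀ := by positivity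
  set κ : ℝ := min κ₀ 1
  have hκ0 : 0 < κ := lt_min hκ₀0 one_pos
  have hκ1 : κ ≤ 1 := min_le_right _ _
  set K : ℝ := (√(2 * Real.pi * v₀))⁻¹ * √(4 * Real.pi * σ2 / a)
  have hK0 : 0 ≤ K := by positivity
  set d : ℝ := min (c ^ 2) (δ / 2)
  have hd0 : 0 < d := lt_min (by positivity) (by positivity)
  set c₁ : ℝ := a * d / (4 * σ2) with hc₁
  have hc₁0 : 0 < c₁ := by positivity
  -- With this threshold for the average score, the score contributes at most `n ^ (w / 8)` to the
  -- likelihood, `w` the number of covariates.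
  set τ : ℕ → ℝ := fun n => a * σ2 * (Real.log n / 8) with hτ
  have hlogtop : Tendsto (fun n : ℕ => Real.log n) atTop atTop :=
    Real.tendsto_log_atTop.comp tendsto_natCast_atTop_atTop
  have hover := (tendsto_overfit_rate K κ l).eventually_lt_const (lt_min hη one_pos)
  have hunder : ∀ᶠ n : ℕ in atTop, Real.exp (-(c₁ / 2 * n)) < η := by
    refine (Real.tendsto_exp_neg_atTop_nhds_zero.comp (Tendsto.const_mul_atTop
      (half_pos hc₁0) tendsto_natCast_atTop_atTop)).eventually_lt_const hη
  have hbound : ∀ᶠ n : ℕ in atTop, responseLaw (x n) σ2 tstar (βstar n)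
      {y | η ≤ |bayesFactor (x n) σ2 (V n) t (m n) tstar (activeCovariates (βstar n)) y|} ≤
      ENNReal.ofReal (σ2 * K₀ ^ 2 / τ n) := by
    filter_upwards [hab, hB, hover, hunder, hlogtop.eventually_ge_atTop 1,
      eventually_gt_atTop 0, hA3.eventually_mul_log_le
        (1 / 4 + (lstar + 1) * (1 / 2 - Real.log κ)) (half_pos hc₁0)] with
      n hA hB hover hunder hlog hn hq
    set ms := activeCovariates (βstar n)
    set w := m n ∪ ms with hw
    have hn0 : (0 : ℝ) < n := by exact_mod_cast hn
    have hwpos : 0 < w.card := Finset.card_pos.2 (hne n)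
    have hw0 : (0 : ℝ) < w.card := by exact_mod_cast hwpos
    have hτ0 : 0 < τ n := by
      have : 0 < Real.log n := one_pos.trans_le hlog
      simp only [hτ]
      positivity
    have hact : ∀ j, ∀ k ∉ ms, βstar n j k = 0 := fun j k hk => by
      by_contra h
      exact hk (Finset.mem_filter.2 ⟨Finset.mem_univ _, j, h⟩)
    have hactw : ∀ j, ∀ k ∉ w, βstar n j k = 0 := fun j k hk =>
      hact j k fun h => hk (Finset.mem_union_right _ h)
    have hCb : ∀ j k, |βstar n j k| ≤ C' := fun j k => by
      by_cases h : βstar n j k = 0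
      · simp [h, hC']
      · exact (hcC n j k h).2.trans (le_max_left _ _)
    have hA' : ∀ (j : Fin (l + 1)) (j' : Fin (lstar + 1)) (h : Fin (p n) → ℝ),
        (∀ k ∉ w, h k = 0) → SegmentsOverlap t tstar j j' → a * n * ∑ k, h k ^ 2 ≤
          ∑ i ∈ jointSegment n t tstar j j', (∑ k, x n i k * h k) ^ 2 :=
      fun j j' h hh hov => (hA j j' h hh hov).1
    have hV0 : (v₀ : ℝ) ≤ V n := by exact_mod_cast (hV n).1
    have hV1 : (V n : ℝ) ≤ v₁ := by exact_mod_cast (hV n).2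
    have hRs : ∀ y, (κ / √n) ^ ((lstar + 1) * ms.card) ≤
        relativeLikelihood (x n) σ2 (V n) tstar ms tstar (βstar n) y := fun y => by
      refine le_trans (pow_le_pow_left₀ (by positivity) ?_ _)
        (le_relativeLikelihood_self hn (x n) hσ2 hv₀' hV0 hV1 hact hCb hB0
          (fun j h hh => (hB j j h (fun k hk => hh k fun hk' =>
            hk (Finset.mem_union_right _ hk')) ?_).2) y)
      · exact div_le_div_of_nonneg_right (min_le_left _ _) (Real.sqrt_nonneg _)
      · simpa [SegmentsOverlap] using segmentStart_lt_segmentEnd hA5 j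
    have hsub : {y | η ≤ |bayesFactor (x n) σ2 (V n) t (m n) tstar ms y|} ⊆
        {y | τ n * n * w.card ≤ scoreSq (x n) t tstar w
          fun i => y i - regressionMean (x n) tstar (βstar n) i} := by
      -- it remains to bound the Bayes factor where the score is below the threshold
      intro y hy
      by_contra hscore
      rw [Set.mem_ofPred_eq, not_le] at hscore
      rw [Set.mem_ofPred_eq, abs_bayesFactor_eq (x n) hσ2 (V n) t (m n) tstar ms (βstar n)] at hy
      set S := scoreSq (x n) t tstar w fun i => y i - regressionMean (x n) tstar (βstar n) i
      have hS : S / (a * n) / σ2 ≤ w.card * (Real.log n / 8) := by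
        rw [div_div, div_le_iff₀ (by positivity)]
        refine hscore.le.trans (le_of_eq ?_)
        simp only [hτ]
        ring
      have hseparated : (∀ β : Fin (l + 1) → Fin (p n) → ℝ, (∀ j, ∀ k ∉ m n, β j k = 0) →
          a * n * d ≤ ∑ j, ∑ j', blockEnergy (x n) t tstar β (βstar n) j j') → False := by
        intro hD
        have hR := relativeLikelihood_le_of_separated hn (x n) σ2 (V n) ht hA5
          (Finset.subset_union_left (s₁ := m n) (s₂ := ms)) ha hA' hactw hD y
        have hratio := underfit_ratio_le (w := w.card) hn hlog
          ((Finset.card_union_le _ _).trans (by linarith [hm n, hmstar n])) (hmstar n) hκ0 hκ1 hq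
          (hR.trans (Real.exp_le_exp.2 ?_)) (hRs y)
        · linarith
        · have : (S / (a * n) - a * n * d / 4) / σ2 = S / (a * n) / σ2 - c₁ * n := by
            rw [sub_div, hc₁]
            congr 1
            field_simp
          rw [this]
          linarith
      rcases lt_or_gt_of_ne hl with hlt | hgt
      · -- with fewer change points than the truth, some true change point is missed
        obtain ⟨r, hr⟩ : ∃ r, tstar r ∉ Set.range t := by
          by_contra! hall
          choose g hg using hall
          have hinj : Function.Injective g := fun r r' h =>
            hA5.1.injective (by rw [← hg r, ← hg r', h])
          have := Fintype.card_le_of_injective g hinj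
          simp only [Fintype.card_fin] at this
          omega
        refine hseparated fun β hβ => le_trans ?_ (energy_ge_of_missing_changePoint (x n) ht hA5
          ha hA' (fun j k hk => hβ j k fun h => hk (Finset.mem_union_left _ h)) hactw hr
          (hjump n r))
        exact mul_le_mul_of_nonneg_left (min_le_right _ _) (by positivity)
      · by_cases hsubset : ms ⊆ m n
        · -- the model contains all true covariates and has more segments than the truth
          have hcard : (m n).card = w.card := by rw [hw, Finset.union_eq_left.2 hsubset]
          have hR := relativeLikelihood_le_of_slab hn (x n) hσ2 hv₀' hV0 ht hA5
            (Finset.subset_union_left (s₁ := m n) (s₂ := ms)) ha hA' hactw y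
          rw [hcard] at hR
          have hratio := overfit_ratio_le (l := l) (w := w.card) (K := K / √n) (E := Real.exp (Real.log n / 8))
            (u := Real.exp (S / (a * n) / σ2)) (by omega)
            (Finset.card_le_card Finset.subset_union_right) (by positivity)
            (by positivity : 0 < κ / √n)
            (div_le_one_of_le₀ (hκ1.trans (Real.one_le_sqrt.2 (by exact_mod_cast hn)))
              (Real.sqrt_nonneg _))
            (Real.exp_pos _).le
            (by rw [← Real.exp_nat_mul, Real.exp_le_exp]; exact hS)
            hR (hRs y)
          have hg0 : 0 ≤ Real.exp (Real.log n / 8) * (K / √n) ^ (l + 1) / (κ / √n) ^ l := by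
            positivity
          have hpow := pow_le_of_le_one hg0 (hover.le.trans (min_le_right _ _)) hwpos.ne'
          linarith [hover.trans_le (min_le_left _ _)]
        · -- some true covariate is missed
          obtain ⟨k, hk, hkm⟩ := Finset.not_subset.1 hsubset
          obtain ⟨j', hj'⟩ := (Finset.mem_filter.1 hk).2
          refine hseparated fun β hβ => le_trans ?_ (energy_ge_of_missing_covariate (x n) ht hA5
            ha hA' (fun j k hk => hβ j k fun h => hk (Finset.mem_union_left _ h)) hactw
            (fun j => hβ j k hkm) hc.le (hcC n j' k hj').1)
          exact mul_le_mul_of_nonneg_left (min_le_left _ _) (by positivity)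
    refine (measure_mono hsub).trans ((responseLaw_scoreSq_ge_le (x n) σ2 tstar (βstar n) t tstar w
      (hK₀ n) (by positivity)).trans (le_of_eq ?_))
    congr 1
    field_simp
  have hlim : Tendsto (fun n => ENNReal.ofReal (σ2 * K₀ ^ 2 / τ n)) atTop (𝓝 0) := by
    rw [← ENNReal.ofReal_zero]
    refine ENNReal.tendsto_ofReal (Tendsto.const_div_atTop ?_ _)
    exact (hlogtop.atTop_div_const (by norm_num)).const_mul_atTop (by positivity)
  exact tendsto_of_tendsto_of_tendsto_of_le_of_le' tendsto_const_nhds hlim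
    (Eventually.of_forall fun _ => zero_le) hbound
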